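/- **Setting.** Let $K\ge 1$, let $\mathcal K:\mathbb R\to\mathbb R$ be square integrable, $\mathcal K_2(u)=\int \mathcal K(u+v)\mathcal K(v)\,dv$, let $h>0$ be a fixed bandwidth, $\kappa(x)=\mathcal K_{2,h}(x)=\mathcal K_2(x/h)/h$, and let $\sigma_1,\dots,\sigma_K>0$ be known scale factors. Let $\mathbf Y(n)=(Y_1(n),\dots,Y_K(n))$, $n=1,2,\dots$, be independent copies of a random vector $\mathbf Y=(Y_1,\dots,Y_K)$ in $\mathbb R^K$. Put $$\pi_{\mathbf Y}(\mathbf y)=E\Big[\prod_{k}\kappa\big(\tfrac{y_k-Y_k}{\sigma_k}\big)\Big],\quad \pi_k(t)=E\big[\kappa\big(\tfrac{t-Y_k}{\sigma_k}\big)\big],\quad \widetilde\pi_l(t)=E\Big[\prod_{k\ne l}\pi_k(Y_k)\,\kappa\big(\tfrac{Y_l-t}{\sigma_l}\big)\Big],\quad c_l=\prod_{k\neq l}E[\pi_k(Y_k)],$$ $\theta_1=E[\pi_{\mathbf Y}(\mathbf Y)]$, $\theta_2=\prod_kE[\pi_k(Y_k)]$, $\theta_3=E[\prod_k\pi_k(Y_k)]$.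 For a sample of size $N\ge1$ let $\widehat E\phi(\mathbf Y)=\frac1N\sum_{n=1}^N\phi(\mathbf Y(n))$, $\widehat\pi_{\mathbf Y}(\mathbf y)=\frac1N\sum_n\prod_k\kappa(\frac{y_k-Y_k(n)}{\sigma_k})$, $\widehat\pi_k(t)=\frac1N\sum_n\kappa(\frac{t-Y_k(n)}{\sigma_k})$, and $$\widehat Q=U_1'+U_2'-2U_3',\qquad U_1'=\widehat E[\widehat\pi_{\mathbf Y}(\mathbf Y)],\quad U_2'=\prod_k\widehat E[\widehat\pi_k(Y_k)],\quad U_3'=\widehat E\Big[\prod_k\widehat\pi_k(Y_k)\Big].$$ **Decomposition.** For all $N\ge1$ and every sample, $$U_1'=\tfrac{N-1}{N}U_1+\tfrac{b_N^{(1)}}{\sqrt N},\qquad U_2'=\tfrac{\binom N{2K}(2K)!}{N^{2K}}U_2+\tfrac{b_N^{(2)}}{\sqrt N},\qquad U_3'=\tfrac{\binom N{K+1}(K+1)!}{N^{K+1}}U_3+\tfrac{b_N^{(3)}}{\sqrt N}.$$ Here $U_1=\frac2{N(N-1)}\sum_{i<j}\prod_k\kappa(\frac{Y_k(i)-Y_k(j)}{\sigma_k})$;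 $U_2$ is the average of $\prod_k\kappa(\frac{Y_k(i_k)-Y_k(j_k)}{\sigma_k})$ over the tuples $(i_1,\dots,i_K,j_1,\dots,j_K)\in\{1,\dots,N\}^{2K}$ with pairwise distinct entries; $U_3$ is the average of $\prod_k\kappa(\frac{Y_k(i_k)-Y_k(j)}{\sigma_k})$ over the tuples $(i_1,\dots,i_K,j)\in\{1,\dots,N\}^{K+1}$ with pairwise distinct entries (a $U_i$ for which no such tuple exists is read as $0$); $b_N^{(1)}=\frac1{\sqrt N}\kappa(0)^K$; and $b_N^{(2)}$, $b_N^{(3)}$ are $\sqrt N\,N^{-2K}$, respectively $\sqrt N\,N^{-(K+1)}$, times the sum of the same products over the tuples that have a repeated entry. There is a constant $C$ such that $|b_N^{(i)}/\sqrt N|\le C/N$ for $i=1,2,3$, all $N\ge1$ and every sample; the $b_N^{(i)}$ are square integrable and $E[(b_N^{(i)})^2]\to0$ as $N\to\infty$. **Variance.** $\widehat Q$ is square integrable and, as $N\to\infty$, $$\operatorname{var}(\widehat Q)=\frac4N\Sigma_{11}+\frac{4K^2}N\Sigma_{22}+\frac{4(K+1)^2}N\Sigma_{33}-\frac{8(K+1)}N\Sigma_{13}-\frac{8K(K+1)}N\Sigma_{23}+\frac{8K}N\Sigma_{12}+o(1/N),$$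 where the following quantities do not depend on $N$: $$\Sigma_{11}=E[\pi_{\mathbf Y}(\mathbf Y)^2]-\theta_1^2,\qquad \Sigma_{22}=\frac1{K^2}\sum_{l,m}c_lc_m\,E[\pi_l(Y_l)\pi_m(Y_m)]-\theta_2^2,$$ $$\Sigma_{33}=\frac1{(K+1)^2}\Big(E\Big[\prod_k\pi_k(Y_k)^2\Big]+\sum_{l,m}E[\widetilde\pi_l(Y_l)\widetilde\pi_m(Y_m)]+2\sum_lE\Big[\prod_k\pi_k(Y_k)\,\widetilde\pi_l(Y_l)\Big]\Big)-\theta_3^2,$$ $$\Sigma_{12}=\frac1K\sum_lc_l\,E[\pi_l(Y_l)\pi_{\mathbf Y}(\mathbf Y)]-\theta_1\theta_2,$$ $$\Sigma_{13}=\frac1{K+1}\Big(E\Big[\pi_{\mathbf Y}(\mathbf Y)\prod_k\pi_k(Y_k)\Big]+\sum_lE[\pi_{\mathbf Y}(\mathbf Y)\widetilde\pi_l(Y_l)]\Big)-\theta_1\theta_3,$$ $$\Sigma_{23}=\frac1{K(K+1)}\Big(\sum_lc_l\,E\Big[\pi_l(Y_l)\prod_k\pi_k(Y_k)\Big]+\sum_{l,m}c_l\,E[\pi_l(Y_l)\widetilde\pi_m(Y_m)]\Big)-\theta_2\theta_3.$$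 In particular $\operatorname{var}(\widehat Q)\to0$ as $N\to\infty$ for every fixed bandwidth $h$. -/

import Mathlib

open MeasureTheory ProbabilityTheory Filter Topology Asymptotics
open scoped BigOperators

noncomputable section

namespace QuadDep

/-- The convolution of `𝒦` with its mirror, `𝒦₂(u) = ∫ 𝒦(u + v) 𝒦(v) dv`. -/
def mirrorConv (𝒦 : ℝ → ℝ) (u : ℝ) : ℝ := ∫ v, 𝒦 (u + v) * 𝒦 v

/-- Rescaling of a kernel by a bandwidth, `k_h(x) = k(x / h) / h`. -/
def rescale (k : ℝ → ℝ) (h x : ℝ) : ℝ := k (x / h) / h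

/-! In what follows `κ` plays the part of `𝒦_{2,h}`, `σ` is the vector of scale factors, `μ` is the
law of the random vector `𝐘 = (Y_1, …, Y_K)`, and `y : Fin N → Fin K → ℝ` is a sample of size `N`,
the number `y n k` being `Y_k(n)`. -/

section Population

variable {K : ℕ} (κ : ℝ → ℝ) (σ : Fin K → ℝ) (μ : Measure (Fin K → ℝ))

/-- `π_𝐘(y) = E[∏ᵢ κ((yᵢ - Yᵢ)/σᵢ)]`. -/
def piJoint (y : Fin K → ℝ) : ℝ := ∫ x, ∏ i, κ ((y i - x i) / σ i) ∂μ

/-- `π_{Y_k}(t) = E[κ((t - Y_k)/σ_k)]`. -/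
def piMarg (k : Fin K) (t : ℝ) : ℝ := ∫ x, κ ((t - x k) / σ k) ∂μ

/-- `π̃_{Y_l}(t) = E[∏_{k ≠ l} π_{Y_k}(Y_k) · κ((Y_l - t)/σ_l)]`. -/
def piTilde (l : Fin K) (t : ℝ) : ℝ :=
  ∫ x, (∏ k ∈ Finset.univ.erase l, piMarg κ σ μ k (x k)) * κ ((x l - t) / σ l) ∂μ

/-- `∏_{k ≠ l} E[π_{Y_k}(Y_k)]`. -/
def prodMeanExcept (l : Fin K) : ℝ :=
  ∏ k ∈ Finset.univ.erase l, ∫ y, piMarg κ σ μ k (y k) ∂μ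

/-- `θ₁ = E[π_𝐘(𝐘)]`. -/
def theta1 : ℝ := ∫ y, piJoint κ σ μ y ∂μ

/-- `θ₂ = ∏ₖ E[π_{Y_k}(Y_k)]`. -/
def theta2 : ℝ := ∏ k, ∫ y, piMarg κ σ μ k (y k) ∂μ

/-- `θ₃ = E[∏ₖ π_{Y_k}(Y_k)]`. -/
def theta3 : ℝ := ∫ y, ∏ k, piMarg κ σ μ k (y k) ∂μ

def Sigma11 : ℝ := (∫ y, piJoint κ σ μ y ^ 2 ∂μ) - theta1 κ σ μ ^ 2

def Sigma22 : ℝ :=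
  1 / (K : ℝ) ^ 2 * (∑ l, ∑ m, prodMeanExcept κ σ μ l * prodMeanExcept κ σ μ m *
    ∫ y, piMarg κ σ μ l (y l) * piMarg κ σ μ m (y m) ∂μ) - theta2 κ σ μ ^ 2

def Sigma33 : ℝ :=
  1 / ((K : ℝ) + 1) ^ 2 * (∫ y, ∏ k, piMarg κ σ μ k (y k) ^ 2 ∂μ)
    + 1 / ((K : ℝ) + 1) ^ 2 *
      (∑ l, ∑ m, ∫ y, piTilde κ σ μ l (y l) * piTilde κ σ μ m (y m) ∂μ)
    + 2 / ((K : ℝ) + 1) ^ 2 *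
      (∑ l, ∫ y, (∏ k, piMarg κ σ μ k (y k)) * piTilde κ σ μ l (y l) ∂μ)
    - theta3 κ σ μ ^ 2

def Sigma12 : ℝ :=
  1 / (K : ℝ) * (∑ l, prodMeanExcept κ σ μ l *
    ∫ y, piMarg κ σ μ l (y l) * piJoint κ σ μ y ∂μ) - theta1 κ σ μ * theta2 κ σ μ

def Sigma13 : ℝ :=
  1 / ((K : ℝ) + 1) * (∫ y, piJoint κ σ μ y * ∏ k, piMarg κ σ μ k (y k) ∂μ)
    + 1 / ((K : ℝ) + 1) * (∑ l, ∫ y, piJoint κ σ μ y * piTilde κ σ μ l (y l) ∂μ)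
    - theta1 κ σ μ * theta3 κ σ μ

def Sigma23 : ℝ :=
  1 / ((K : ℝ) * ((K : ℝ) + 1)) * (∑ l, prodMeanExcept κ σ μ l *
      ∫ y, piMarg κ σ μ l (y l) * ∏ k, piMarg κ σ μ k (y k) ∂μ)
    + 1 / ((K : ℝ) * ((K : ℝ) + 1)) * (∑ l, ∑ m, prodMeanExcept κ σ μ l *
      ∫ y, piMarg κ σ μ l (y l) * piTilde κ σ μ m (y m) ∂μ)
    - theta2 κ σ μ * theta3 κ σ μ

end Population

section Estimator

/-- The sample average `Ê φ(𝐘) = (1/N) ∑ₙ φ(𝐘(n))`. -/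
def sampleMean {N : ℕ} {E : Type*} (y : Fin N → E) (φ : E → ℝ) : ℝ :=
  1 / (N : ℝ) * ∑ n, φ (y n)

variable {K N : ℕ} (κ : ℝ → ℝ) (σ : Fin K → ℝ) (y : Fin N → Fin K → ℝ)

/-- `π̂_𝐘`. -/
def piJointHat (t : Fin K → ℝ) : ℝ := sampleMean y fun x => ∏ i, κ ((t i - x i) / σ i)

/-- `π̂_{Y_k}`. -/
def piMargHat (k : Fin K) (t : ℝ) : ℝ := sampleMean y fun x => κ ((t - x k) / σ k)

/-- `U'₁ = Ê[π̂_𝐘(𝐘)]`. -/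
def V1 : ℝ := sampleMean y fun x => piJointHat κ σ y x

/-- `U'₂ = ∏ₖ Ê[π̂_{Y_k}(Y_k)]`. -/
def V2 : ℝ := ∏ k, sampleMean y fun x => piMargHat κ σ y k (x k)

/-- `U'₃ = Ê[∏ₖ π̂_{Y_k}(Y_k)]`. -/
def V3 : ℝ := sampleMean y fun x => ∏ k, piMargHat κ σ y k (x k)

/-- `Q̂ = U'₁ + U'₂ - 2 U'₃`. -/
def QHat : ℝ := V1 κ σ y + V2 κ σ y - 2 * V3 κ σ y

/-- The U-statistic `U₁ = 2/(N(N-1)) ∑_{i<j} ∏ₖ κ((Y_k(i) - Y_k(j))/σ_k)`. -/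
def U1 : ℝ :=
  2 / ((N : ℝ) * ((N : ℝ) - 1)) *
    ∑ i : Fin N, ∑ j ∈ Finset.Ioi i, ∏ k, κ ((y i k - y j k) / σ k)

/-- The summand `∏ₖ κ((Y_k(iₖ) - Y_k(jₖ))/σ_k)` for a tuple `s = (i₁, …, i_K, j₁, …, j_K)`. -/
def term2 (s : Fin K ⊕ Fin K → Fin N) : ℝ :=
  ∏ k, κ ((y (s (Sum.inl k)) k - y (s (Sum.inr k)) k) / σ k)

/-- The U-statistic `U₂`: the mean of `term2` over the tuples with pairwise different entries. -/
def U2 : ℝ :=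
  1 / (N.descFactorial (2 * K) : ℝ) *
    ∑ s : Fin K ⊕ Fin K → Fin N with Function.Injective s, term2 κ σ y s

/-- The summand `∏ₖ κ((Y_k(iₖ) - Y_k(j))/σ_k)` for a tuple `s = (i₁, …, i_K, j)`. -/
def term3 (s : Fin (K + 1) → Fin N) : ℝ :=
  ∏ k : Fin K, κ ((y (s k.castSucc) k - y (s (Fin.last K)) k) / σ k)

/-- The U-statistic `U₃`: the mean of `term3` over the tuples with pairwise different entries. -/
def U3 : ℝ :=
  1 / (N.descFactorial (K + 1) : ℝ) *
    ∑ s : Fin (K + 1) → Fin N with Function.Injective s, term3 κ σ y s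

/-- `b_N^{(1)} = N^{-1/2} ∏ₖ κ(0)`. -/
def b1 (K N : ℕ) (κ : ℝ → ℝ) : ℝ := 1 / √(N : ℝ) * ∏ _k : Fin K, κ 0

/-- `b_N^{(2)}`: the sum of `term2` over the tuples with a repeated entry, times
`N^{-1/2} N^{-(2K-1)} = √N / N^{2K}`. -/
def b2 : ℝ :=
  √(N : ℝ) / (N : ℝ) ^ (2 * K) *
    ∑ s : Fin K ⊕ Fin K → Fin N with ¬ Function.Injective s, term2 κ σ y s

/-- `b_N^{(3)}`: the sum of `term3` over the tuples with a repeated entry, times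
`N^{-1/2} N^{-K} = √N / N^{K+1}`. -/
def b3 : ℝ :=
  √(N : ℝ) / (N : ℝ) ^ (K + 1) *
    ∑ s : Fin (K + 1) → Fin N with ¬ Function.Injective s, term3 κ σ y s

end Estimator

end QuadDep

end

/-! Multiplying out the sums turns the three statistics into V-statistics with kernels `ker1`,
`ker2`, `ker3` of orders 2, 2K and K + 1. A square integrable 𝒦 has a bounded, even, measurable
convolution 𝒦₂, so every function involved is bounded and all integrability questions are trivial.
The decomposition separates injective from non-injective index tuples; the latter are a fraction
O(1/N) of all tuples and the summands are bounded, which controls the remainders for every sample.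

The variance comes from a first order Hoeffding expansion. Subtracting from a kernel its mean and
its centred one-variable projections `kernelProj` leaves a degenerate kernel. In the second moment
of its V-statistic, two injective tuples contribute only if they share at least two indices
(`integral_mul_eq_zero_of_degenerate`, by way of `integral_resample`), so that moment is O(1/N²)
(`integral_vStat_sq_le_of_degenerate`). Hence `QHat` is, up to O(1/N) in L², a constant plus the
sample mean of g = 2 `piJoint` + 2 `linPart2` - 2 `linPart3` (`QHat_linearization`), and
`variance_sub_isLittleO` turns this into var(g)/N + o(1/N).

It remains to identify var(g). Independence makes the projections of the product kernels explicit
(the `kernelProj_ker…` lemmas), and `variance_linPart` expands var(g) into covariances, which are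
the Σ's up to powers of K and K + 1. -/

noncomputable section

namespace QuadDep

/-! ### Counting index tuples with coincidences -/

section Counting

variable {ι α : Type*} [Fintype ι] [DecidableEq ι] [Fintype α] [DecidableEq α]

/-- Prescribing the values at two different points costs a factor `|α|²`. -/
lemma card_filter_two_values {a b : ι} (hab : a ≠ b) (p q : α) :
    (Finset.univ.filter fun s : ι → α => s a = p ∧ s b = q).card * Fintype.card α ^ 2 =
      Fintype.card α ^ Fintype.card ι := by
  have hset : (Finset.univ.filter fun s : ι → α => s a = p ∧ s b = q) =
      Fintype.piFinset fun c => if c = a then {p} else if c = b then {q} else Finset.univ := by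
    ext s
    simp only [Finset.mem_filter, Finset.mem_univ, true_and, Fintype.mem_piFinset]
    constructor
    · rintro ⟨h1, h2⟩ c
      by_cases hca : c = a
      · subst hca; simp [h1]
      · by_cases hcb : c = b
        · subst hcb; simp [hca, h2]
        · simp [hca, hcb]
    · intro h
      have h1 := h a
      have h2 := h b
      simp only [if_true, hab.symm, if_false, Finset.mem_singleton] at h1 h2
      exact ⟨h1, h2⟩
  rw [hset, Fintype.card_piFinset, ← Finset.mul_prod_erase Finset.univ _ (Finset.mem_univ a),
    ← Finset.mul_prod_erase (Finset.univ.erase a) _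
      (Finset.mem_erase.2 ⟨hab.symm, Finset.mem_univ b⟩)]
  have hrest : ∏ c ∈ (Finset.univ.erase a).erase b,
      (if c = a then {p} else if c = b then {q} else (Finset.univ : Finset α)).card =
      Fintype.card α ^ (Fintype.card ι - 2) := by
    rw [Finset.prod_congr rfl (g := fun _ => Fintype.card α)]
    · rw [Finset.prod_const, Finset.card_erase_of_mem, Finset.card_erase_of_mem, Finset.card_univ]
      · rfl
      · exact Finset.mem_univ a
      · exact Finset.mem_erase.2 ⟨hab.symm, Finset.mem_univ b⟩
    · intro c hc
      simp only [Finset.mem_erase] at hc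
      simp [hc.1, hc.2.1]
  -- Two distinct points make the exponent `card ι - 2` a genuine subtraction.
  have h2 : 2 ≤ Fintype.card ι := Fintype.one_lt_card_iff.2 ⟨a, b, hab⟩
  rw [hrest]
  simp only [if_true, hab.symm, if_false, Finset.card_singleton, one_mul]
  rw [← pow_add]
  congr 1
  omega

/-- There are at most `m² |α|^(m-1)` maps that are not injective. -/
lemma card_filter_not_injective_mul_le :
    (Finset.univ.filter fun s : ι → α => ¬ Function.Injective s).card * Fintype.card α ≤
      Fintype.card ι ^ 2 * Fintype.card α ^ Fintype.card ι := by
  rcases Nat.eq_zero_or_pos (Fintype.card α) with h0 | hpos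
  · simp [h0]
  have hsub : (Finset.univ.filter fun s : ι → α => ¬ Function.Injective s) ⊆
      (Finset.univ.filter fun ab : ι × ι => ab.1 ≠ ab.2).biUnion fun ab =>
        (Finset.univ : Finset α).biUnion fun p =>
          Finset.univ.filter fun s : ι → α => s ab.1 = p ∧ s ab.2 = p := by
    intro s hs
    simp only [Finset.mem_filter, Finset.mem_univ, true_and, Function.Injective, not_forall] at hs
    obtain ⟨a, b, hs, hab⟩ := hs
    simp only [Finset.mem_biUnion, Finset.mem_filter, Finset.mem_univ, true_and]
    exact ⟨(a, b), hab, s a, rfl, hs.symm⟩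
  -- A further factor |α| is inserted because `card_filter_two_values` counts in multiples of |α|².
  refine Nat.le_of_mul_le_mul_right ?_ hpos
  calc _ = (Finset.univ.filter fun s : ι → α => ¬ Function.Injective s).card *
        Fintype.card α ^ 2 := by ring
    _ ≤ (∑ ab ∈ Finset.univ.filter (fun ab : ι × ι => ab.1 ≠ ab.2), ∑ p : α,
        (Finset.univ.filter fun s : ι → α => s ab.1 = p ∧ s ab.2 = p).card) *
          Fintype.card α ^ 2 := by
        gcongr
        exact (Finset.card_le_card hsub).trans (Finset.card_biUnion_le.trans
          (Finset.sum_le_sum fun _ _ => Finset.card_biUnion_le))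
    _ = ∑ ab ∈ Finset.univ.filter (fun ab : ι × ι => ab.1 ≠ ab.2), ∑ _p : α,
          Fintype.card α ^ Fintype.card ι := by
        rw [Finset.sum_mul]
        refine Finset.sum_congr rfl fun ab hab => ?_
        rw [Finset.sum_mul]
        exact Finset.sum_congr rfl fun p _ =>
          card_filter_two_values (Finset.mem_filter.1 hab).2 p p
    _ ≤ ∑ ab : ι × ι, ∑ _p : α, Fintype.card α ^ Fintype.card ι :=
        Finset.sum_le_sum_of_subset (Finset.filter_subset _ _)
    _ = _ := by
        simp only [Finset.sum_const, Finset.card_univ, Fintype.card_prod, smul_eq_mul]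
        ring

/-- There are at most `m⁴ |α|^(2m-2)` pairs of maps with two coincidences. -/
lemma card_filter_two_coincidences_mul_le :
    (Finset.univ.filter fun st : (ι → α) × (ι → α) =>
        ∃ a b c d, a ≠ b ∧ st.1 a = st.2 c ∧ st.1 b = st.2 d).card * Fintype.card α ^ 2 ≤
      Fintype.card ι ^ 4 * (Fintype.card α ^ Fintype.card ι) ^ 2 := by
  have hsub : (Finset.univ.filter fun st : (ι → α) × (ι → α) =>
        ∃ a b c d, a ≠ b ∧ st.1 a = st.2 c ∧ st.1 b = st.2 d) ⊆
      -- For fixed t the map s is prescribed at the distinct points a and b. The points c and d of t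
      -- need not differ.
      (Finset.univ.filter fun q : (ι × ι) × ι × ι => q.1.1 ≠ q.1.2).biUnion fun q =>
        (Finset.univ : Finset (ι → α)).biUnion fun t =>
          (Finset.univ.filter fun s : ι → α => s q.1.1 = t q.2.1 ∧ s q.1.2 = t q.2.2).image
            fun s => (s, t) := by
    rintro ⟨s, t⟩ hst
    simp only [Finset.mem_filter, Finset.mem_univ, true_and] at hst
    obtain ⟨a, b, c, d, hab, h1, h2⟩ := hst
    simp only [Finset.mem_biUnion, Finset.mem_filter, Finset.mem_univ, true_and, Finset.mem_image]
    exact ⟨((a, b), c, d), hab, t, s, ⟨h1, h2⟩, rfl⟩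
  calc _ ≤ (∑ q ∈ Finset.univ.filter (fun q : (ι × ι) × ι × ι => q.1.1 ≠ q.1.2), ∑ t : ι → α,
        (Finset.univ.filter fun s : ι → α => s q.1.1 = t q.2.1 ∧ s q.1.2 = t q.2.2).card) *
          Fintype.card α ^ 2 := by
        gcongr
        exact (Finset.card_le_card hsub).trans (Finset.card_biUnion_le.trans
          (Finset.sum_le_sum fun _ _ => Finset.card_biUnion_le.trans
            (Finset.sum_le_sum fun _ _ => Finset.card_image_le)))
    _ = ∑ q ∈ Finset.univ.filter (fun q : (ι × ι) × ι × ι => q.1.1 ≠ q.1.2), ∑ _t : ι → α,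
          Fintype.card α ^ Fintype.card ι := by
        rw [Finset.sum_mul]
        refine Finset.sum_congr rfl fun q hq => ?_
        rw [Finset.sum_mul]
        exact Finset.sum_congr rfl fun t _ =>
          card_filter_two_values (Finset.mem_filter.1 hq).2 _ _
    _ ≤ ∑ q : (ι × ι) × ι × ι, ∑ _t : ι → α, Fintype.card α ^ Fintype.card ι :=
        Finset.sum_le_sum_of_subset (Finset.filter_subset _ _)
    _ = _ := by
        simp only [Finset.sum_const, Finset.card_univ, Fintype.card_prod, smul_eq_mul,
          Fintype.card_fun]
        ring

end Counting

/-! ### V-statistics and their diagonal part -/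

section VStatistic

variable {ι E : Type*} [Fintype ι] [DecidableEq ι]

/-- The V-statistic with kernel `φ`. -/
def vStat {N : ℕ} (φ : (ι → E) → ℝ) (x : Fin N → E) : ℝ :=
  1 / (N : ℝ) ^ Fintype.card ι * ∑ s : ι → Fin N, φ fun a => x (s a)

/-- Non-injective tuples are at most a fraction m²/N of all tuples. This serves both the remainders
`b2`, `b3` and the diagonal part of a degenerate V-statistic. -/
lemma abs_sum_not_injective_le {N : ℕ} (hN : 1 ≤ N) {f : (ι → Fin N) → ℝ} {M : ℝ}
    (hf : ∀ s, |f s| ≤ M) :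
    |1 / (N : ℝ) ^ Fintype.card ι * ∑ s : ι → Fin N with ¬ Function.Injective s, f s| ≤
      (Fintype.card ι : ℝ) ^ 2 * M / N := by
  have hN0 : (0 : ℝ) < N := by exact_mod_cast hN
  -- Since N ≥ 1, a constant tuple exists, and the bound on it forces M ≥ 0.
  have hM : 0 ≤ M := (abs_nonneg _).trans (hf fun _ => ⟨0, hN⟩)
  have hc := card_filter_not_injective_mul_le (ι := ι) (α := Fin N)
  rw [Fintype.card_fin] at hc
  have hc' : ((Finset.univ.filter fun s : ι → Fin N => ¬ Function.Injective s).card : ℝ) * N ≤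
      (Fintype.card ι : ℝ) ^ 2 * (N : ℝ) ^ Fintype.card ι := by exact_mod_cast hc
  have hs : |∑ s : ι → Fin N with ¬ Function.Injective s, f s| ≤
      (Finset.univ.filter fun s : ι → Fin N => ¬ Function.Injective s).card * M := by
    refine (Finset.abs_sum_le_sum_abs _ _).trans ?_
    refine (Finset.sum_le_card_nsmul _ _ M fun s _ => hf s).trans_eq ?_
    rw [nsmul_eq_mul]
  rw [abs_mul, abs_of_nonneg (by positivity : (0 : ℝ) ≤ 1 / (N : ℝ) ^ Fintype.card ι),
    le_div_iff₀ hN0, div_mul_eq_mul_div, one_mul, div_mul_eq_mul_div, div_le_iff₀ (by positivity)]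
  calc _ ≤ (Finset.univ.filter fun s : ι → Fin N => ¬ Function.Injective s).card * M * N := by
        gcongr
    _ = ((Finset.univ.filter fun s : ι → Fin N => ¬ Function.Injective s).card : ℝ) * N * M := by
        ring
    _ ≤ (Fintype.card ι : ℝ) ^ 2 * (N : ℝ) ^ Fintype.card ι * M := by gcongr
    _ = _ := by ring

end VStatistic

/-! ### A class of functions closed under algebra and partial integration -/

/-- Bounded measurable real functions. -/
structure IsBddMeas {X : Type*} [MeasurableSpace X] (f : X → ℝ) : Prop where
  measurable : Measurable f
  bounded : ∃ C, ∀ x, |f x| ≤ C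

namespace IsBddMeas

variable {X Z : Type*} [MeasurableSpace X] [MeasurableSpace Z] {f g : X → ℝ}

lemma const (c : ℝ) : IsBddMeas fun _ : X => c := ⟨measurable_const, |c|, fun _ => le_rfl⟩

lemma comp {u : Z → X} (hf : IsBddMeas f) (hu : Measurable u) : IsBddMeas fun z => f (u z) :=
  ⟨hf.measurable.comp hu, hf.bounded.imp fun _ h z => h (u z)⟩

lemma add (hf : IsBddMeas f) (hg : IsBddMeas g) : IsBddMeas fun x => f x + g x := by
  obtain ⟨C, hC⟩ := hf.bounded
  obtain ⟨D, hD⟩ := hg.bounded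
  exact ⟨hf.measurable.add hg.measurable, C + D,
    fun x => (abs_add_le _ _).trans (add_le_add (hC x) (hD x))⟩

lemma mul (hf : IsBddMeas f) (hg : IsBddMeas g) : IsBddMeas fun x => f x * g x := by
  obtain ⟨C, hC⟩ := hf.bounded
  obtain ⟨D, hD⟩ := hg.bounded
  refine ⟨hf.measurable.mul hg.measurable, C * D, fun x => ?_⟩
  rw [abs_mul]
  exact mul_le_mul (hC x) (hD x) (abs_nonneg _) ((abs_nonneg _).trans (hC x))

lemma const_mul (c : ℝ) (hf : IsBddMeas f) : IsBddMeas fun x => c * f x := (const c).mul hf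

lemma sub (hf : IsBddMeas f) (hg : IsBddMeas g) : IsBddMeas fun x => f x - g x := by
  simpa [sub_eq_add_neg] using hf.add (hg.const_mul (-1))

lemma pow (hf : IsBddMeas f) (n : ℕ) : IsBddMeas fun x => f x ^ n := by
  induction n with
  | zero => simpa using const (X := X) 1
  | succ n ih => simpa only [pow_succ] using ih.mul hf

lemma sum {α : Type*} (s : Finset α) {F : α → X → ℝ} (hF : ∀ a ∈ s, IsBddMeas (F a)) :
    IsBddMeas fun x => ∑ a ∈ s, F a x := by
  classical
  induction s using Finset.induction_on with
  | empty => simpa using const (X := X) 0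
  | insert a s ha ih =>
    simp only [Finset.sum_insert ha]
    exact (hF a (Finset.mem_insert_self a s)).add
      (ih fun b hb => hF b (Finset.mem_insert_of_mem hb))

lemma prod {α : Type*} (s : Finset α) {F : α → X → ℝ} (hF : ∀ a ∈ s, IsBddMeas (F a)) :
    IsBddMeas fun x => ∏ a ∈ s, F a x := by
  classical
  induction s using Finset.induction_on with
  | empty => simpa using const (X := X) 1
  | insert a s ha ih =>
    simp only [Finset.prod_insert ha]
    exact (hF a (Finset.mem_insert_self a s)).mul
      (ih fun b hb => hF b (Finset.mem_insert_of_mem hb))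

lemma memLp (hf : IsBddMeas f) (μ : Measure X) [IsFiniteMeasure μ] (p : ENNReal) :
    MemLp f p μ := by
  obtain ⟨C, hC⟩ := hf.bounded
  exact MemLp.of_bound hf.measurable.aestronglyMeasurable C (ae_of_all _ hC)

lemma integrable (hf : IsBddMeas f) (μ : Measure X) [IsFiniteMeasure μ] : Integrable f μ :=
  memLp_one_iff_integrable.1 (hf.memLp μ 1)

/-- The same bound survives because the measure has mass one; measurability in the parameter is part
of Fubini's theorem. -/
lemma integral_right {F : X × Z → ℝ} (hF : IsBddMeas F) (μ : Measure Z) [IsProbabilityMeasure μ] :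
    IsBddMeas fun x => ∫ z, F (x, z) ∂μ := by
  obtain ⟨C, hC⟩ := hF.bounded
  refine ⟨(hF.measurable.stronglyMeasurable.integral_prod_right' (ν := μ)).measurable, C,
    fun x => ?_⟩
  have := norm_integral_le_of_norm_le_const (μ := μ) (f := fun z => F (x, z))
    (ae_of_all _ fun z => hC (x, z))
  simpa using this

end IsBddMeas

/-! ### Replacing observations by independent copies -/

section Resampling

variable {E : Type*} [MeasurableSpace E] (μ : Measure E) [IsProbabilityMeasure μ]

/-- Injectivity ensures that no coordinate is repeated, so the selected coordinates are again
independent with law `μ`. -/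
lemma measurePreserving_precomp {I J : Type*} [Fintype I] [Fintype J] {e : I → J}
    (he : Function.Injective e) :
    MeasurePreserving (fun (w : J → E) i => w (e i)) (Measure.pi fun _ => μ)
      (Measure.pi fun _ => μ) := by
  have hind : iIndepFun (fun (j : J) (w : J → E) => w j) (Measure.pi fun _ => μ) :=
    iIndepFun_pi (X := fun _ => id) fun _ => aemeasurable_id
  have hlaw : ∀ i, HasLaw (fun w : J → E => w (e i)) μ (Measure.pi fun _ => μ) := fun i =>
    (measurePreserving_eval (fun _ : J => μ) (e i)).hasLaw
  have := (hind.precomp he).hasLaw_pi hlaw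
  exact this.measurePreserving (measurable_pi_lambda _ fun i => measurable_pi_apply (e i))

/-- The mean of the kernel `φ` when the argument in position `a` is fixed. -/
def kernelProj {ι : Type*} [Fintype ι] [DecidableEq ι] (φ : (ι → E) → ℝ) (a : ι) (t : E) : ℝ :=
  ∫ z, φ (Function.update z a t) ∂Measure.pi fun _ => μ

variable {ι J : Type*} [Fintype ι] [DecidableEq ι] [Fintype J]

omit [Fintype ι] in
lemma measurable_update_prod (a : ι) :
    Measurable fun p : E × (ι → E) => Function.update p.2 a p.1 := by
  refine measurable_pi_lambda _ fun b => ?_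
  by_cases hb : b = a
  · subst hb; simpa using measurable_fst
  · simpa [hb, Function.comp_def] using (measurable_pi_apply b).comp measurable_snd

lemma IsBddMeas.kernelProj {φ : (ι → E) → ℝ} (hφ : IsBddMeas φ) (a : ι) :
    IsBddMeas (kernelProj μ φ a) :=
  (hφ.comp (measurable_update_prod a)).integral_right (Measure.pi fun _ => μ)

/-- Replacing the entries `x (s b)`, `b ≠ a`, by fresh independent ones does not change a mean. -/
lemma integral_resample {s : ι → J} (hs : Function.Injective s) (a : ι)
    {φ : (ι → E) → ℝ} (hφ : IsBddMeas φ) {G : (J → E) → ℝ} (hG : IsBddMeas G)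
    (hGs : ∀ x x', (∀ j, (∀ b, b ≠ a → s b ≠ j) → x j = x' j) → G x = G x') :
    ∫ x, φ (fun b => x (s b)) * G x ∂Measure.pi (fun _ : J => μ) =
      ∫ x, kernelProj μ φ a (x (s a)) * G x ∂Measure.pi (fun _ : J => μ) := by
  classical
  -- The index s b with b ≠ a is sent to a fresh coordinate b, every other index stays. As `e` is
  -- injective, reading an i.i.d. family over `J ⊕ ι` through `e` gives an i.i.d. family over `J`;
  -- integrating out the fresh coordinates then leaves the projection of φ.
  let e : J → J ⊕ ι := fun j => if h : ∃ b, b ≠ a ∧ s b = j then Sum.inr h.choose else Sum.inl j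
  have he_pos : ∀ b, b ≠ a → e (s b) = Sum.inr b := by
    intro b hb
    have h : ∃ b', b' ≠ a ∧ s b' = s b := ⟨b, hb, rfl⟩
    simp only [e, dif_pos h]
    exact congrArg _ (hs h.choose_spec.2)
  have he_neg : ∀ j, (∀ b, b ≠ a → s b ≠ j) → e j = Sum.inl j := by
    intro j hj
    have h : ¬ ∃ b, b ≠ a ∧ s b = j := fun ⟨b, hb, h⟩ => hj b hb h
    simp only [e, dif_neg h]
  have he : Function.Injective e := by
    intro i j hij
    by_cases hi : ∃ b, b ≠ a ∧ s b = i
    · obtain ⟨b, hb, rfl⟩ := hi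
      by_cases hj : ∃ b, b ≠ a ∧ s b = j
      · obtain ⟨c, hc, rfl⟩ := hj
        rw [he_pos b hb, he_pos c hc] at hij
        rw [Sum.inr.inj hij]
      · push Not at hj
        rw [he_pos b hb, he_neg j hj] at hij
        cases hij
    · push Not at hi
      by_cases hj : ∃ b, b ≠ a ∧ s b = j
      · obtain ⟨c, hc, rfl⟩ := hj
        rw [he_pos c hc, he_neg i hi] at hij
        cases hij
      · push Not at hj
        rw [he_neg i hi, he_neg j hj] at hij
        exact Sum.inl.inj hij
  have hcomp : IsBddMeas fun x : J → E => φ (fun b => x (s b)) * G x :=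
    (hφ.comp (measurable_pi_lambda _ fun b => measurable_pi_apply (s b))).mul hG
  have hmp := (measurePreserving_precomp μ he).comp
    (measurePreserving_sumPiEquivProdPi_symm fun _ : J ⊕ ι => μ)
  rw [← hmp.map_eq, integral_map hmp.measurable.aemeasurable
    hcomp.measurable.aestronglyMeasurable, integral_prod _ ((hcomp.comp hmp.measurable).integrable _),
    hmp.map_eq]
  refine integral_congr_ae (ae_of_all _ fun x => ?_)
  simp only [kernelProj]
  rw [← integral_mul_const]
  refine integral_congr_ae (ae_of_all _ fun z => ?_)
  have hval : ∀ w : J ⊕ ι, (MeasurableEquiv.sumPiEquivProdPi fun _ : J ⊕ ι => E).symm (x, z) w =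
      Sum.elim x z w := by
    rintro (j | b) <;> rfl
  simp only [Function.comp, hval]
  congr 1
  · congr 1
    funext b
    by_cases hb : b = a
    · subst hb
      rw [he_neg (s b) fun c hc h => hc (hs h)]
      simp
    · rw [he_pos b hb]
      simp [hb]
  · refine hGs _ _ fun j hj => ?_
    rw [he_neg j hj]
    rfl

end Resampling

/-! ### The first order Hoeffding expansion -/

section Hoeffding

variable {ι E : Type*} [Fintype ι] [DecidableEq ι] [MeasurableSpace E]
  (μ : Measure E) [IsProbabilityMeasure μ]

lemma measurable_precomp {I J : Type*} (s : I → J) : Measurable fun (x : J → E) i => x (s i) :=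
  measurable_pi_lambda _ fun i => measurable_pi_apply (s i)

lemma IsBddMeas.vStat {φ : (ι → E) → ℝ} (hφ : IsBddMeas φ) (N : ℕ) :
    IsBddMeas fun x : Fin N → E => vStat φ x :=
  (IsBddMeas.sum _ fun s _ => hφ.comp (measurable_precomp s)).const_mul _

/-- With at most one position a of s meeting the range of t, all other entries of s are absent from
the second factor. Resampling them replaces the first factor by its projection at a, which is zero.
-/
lemma integral_mul_eq_zero_of_degenerate [Nonempty ι] {J : Type*} [Fintype J] {ψ : (ι → E) → ℝ}
    (hψ : IsBddMeas ψ) (hdeg : ∀ a t, kernelProj μ ψ a t = 0) {s t : ι → J}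
    (hs : Function.Injective s)
    (hst : ¬ ∃ a b c d, a ≠ b ∧ s a = t c ∧ s b = t d) :
    ∫ x, ψ (fun a => x (s a)) * ψ (fun a => x (t a)) ∂Measure.pi (fun _ : J => μ) = 0 := by
  -- Otherwise an arbitrary position yields some b with s b in the range of t, and b in turn yields
  -- another b' ≠ b: two coincidences.
  obtain ⟨a, ha⟩ : ∃ a, ∀ b, b ≠ a → ∀ c, s b ≠ t c := by
    by_contra! hcon
    obtain ⟨b, -, c, hc⟩ := hcon (Classical.arbitrary ι)
    obtain ⟨b', hb', c', hc'⟩ := hcon b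
    exact hst ⟨b', b, c', c, hb', hc', hc⟩
  rw [integral_resample μ hs a hψ (hψ.comp (measurable_precomp t))]
  · simp [hdeg]
  · intro x x' hx
    exact congrArg ψ (funext fun c => hx _ fun b hb => ha b hb c)

/-- A V-statistic with a degenerate kernel is of order `1/N` in mean square. -/
lemma integral_vStat_sq_le_of_degenerate [Nonempty ι] {ψ : (ι → E) → ℝ}
    (hψ : IsBddMeas ψ) (hdeg : ∀ a t, kernelProj μ ψ a t = 0) :
    ∃ C, ∀ N : ℕ, 1 ≤ N →
      ∫ x, vStat ψ x ^ 2 ∂Measure.pi (fun _ : Fin N => μ) ≤ C / (N : ℝ) ^ 2 := by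
  obtain ⟨M, hM⟩ := hψ.bounded
  refine ⟨2 * ((Fintype.card ι : ℝ) ^ 4 * M ^ 2) + 2 * ((Fintype.card ι : ℝ) ^ 2 * M) ^ 2,
    fun N hN => ?_⟩
  have hN0 : (0 : ℝ) < N := by exact_mod_cast hN
  set m := Fintype.card ι
  set ν := Measure.pi fun _ : Fin N => μ
  -- Degeneracy is usable only on injective tuples, which form A. The rest B is at most m²M/N
  -- pointwise, so its square already has order 1/N².
  let A : (Fin N → E) → ℝ := fun x =>
    1 / (N : ℝ) ^ m * ∑ s : ι → Fin N with Function.Injective s, ψ fun a => x (s a)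
  let B : (Fin N → E) → ℝ := fun x =>
    1 / (N : ℝ) ^ m * ∑ s : ι → Fin N with ¬ Function.Injective s, ψ fun a => x (s a)
  have hAB : ∀ x, vStat ψ x = A x + B x := fun x => by
    simp only [A, B, vStat]
    rw [← mul_add, Finset.sum_filter_add_sum_filter_not]
  have hA : IsBddMeas A :=
    (IsBddMeas.sum _ fun s _ => hψ.comp (measurable_precomp s)).const_mul _
  have hB : ∀ x, B x ^ 2 ≤ ((m : ℝ) ^ 2 * M / N) ^ 2 := fun x => by
    rw [← sq_abs (B x)]
    exact pow_le_pow_left₀ (abs_nonneg _)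
      (abs_sum_not_injective_le hN (f := fun s => ψ fun a => x (s a)) fun s => hM _) 2
  -- Only pairs of tuples with two coincidences survive. There are at most m⁴N^(2m-2) of them among
  -- N^(2m), each contributing at most M².
  have hA2 : ∫ x, A x ^ 2 ∂ν ≤ (m : ℝ) ^ 4 * M ^ 2 / (N : ℝ) ^ 2 := by
    have hexp : ∀ x, A x ^ 2 = 1 / ((N : ℝ) ^ m) ^ 2 *
        ∑ st ∈ (Finset.univ.filter fun s : ι → Fin N => Function.Injective s) ×ˢ
          (Finset.univ.filter fun s : ι → Fin N => Function.Injective s),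
          ψ (fun a => x (st.1 a)) * ψ (fun a => x (st.2 a)) := fun x => by
      rw [Finset.sum_product]
      simp only [A]
      rw [← Finset.sum_mul_sum]
      ring
    have hint : ∀ st : (ι → Fin N) × (ι → Fin N),
        IsBddMeas fun x : Fin N → E => ψ (fun a => x (st.1 a)) * ψ (fun a => x (st.2 a)) :=
      fun st => (hψ.comp (measurable_precomp st.1)).mul (hψ.comp (measurable_precomp st.2))
    have hle : ∀ st : (ι → Fin N) × (ι → Fin N),
        ∫ x, ψ (fun a => x (st.1 a)) * ψ (fun a => x (st.2 a)) ∂ν ≤ M ^ 2 := fun st => by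
      have h1 : ∀ x : Fin N → E, ψ (fun a => x (st.1 a)) * ψ (fun a => x (st.2 a)) ≤ M ^ 2 :=
        fun x => by
          refine (le_abs_self _).trans ?_
          rw [abs_mul, pow_two M]
          have hM0 : 0 ≤ M := (abs_nonneg _).trans (hM fun a => x (st.1 a))
          exact mul_le_mul (hM _) (hM _) (abs_nonneg _) hM0
      calc _ ≤ ∫ _x, M ^ 2 ∂ν :=
            integral_mono ((hint st).integrable ν) (integrable_const _) h1
        _ = M ^ 2 := by simp
    simp only [hexp]
    rw [integral_const_mul, integral_finsetSum _ fun st _ => (hint st).integrable ν]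
    have hc := card_filter_two_coincidences_mul_le (ι := ι) (α := Fin N)
    rw [Fintype.card_fin] at hc
    have hc' : ((Finset.univ.filter fun st : (ι → Fin N) × (ι → Fin N) =>
        ∃ a b c d, a ≠ b ∧ st.1 a = st.2 c ∧ st.1 b = st.2 d).card : ℝ) * (N : ℝ) ^ 2 ≤
        (m : ℝ) ^ 4 * ((N : ℝ) ^ m) ^ 2 := by exact_mod_cast hc
    have hsum : ∑ st ∈ (Finset.univ.filter fun s : ι → Fin N => Function.Injective s) ×ˢ
          (Finset.univ.filter fun s : ι → Fin N => Function.Injective s),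
          ∫ x, ψ (fun a => x (st.1 a)) * ψ (fun a => x (st.2 a)) ∂ν ≤
        (Finset.univ.filter fun st : (ι → Fin N) × (ι → Fin N) =>
          ∃ a b c d, a ≠ b ∧ st.1 a = st.2 c ∧ st.1 b = st.2 d).card * M ^ 2 := by
      calc _ ≤ ∑ st ∈ (Finset.univ.filter fun s : ι → Fin N => Function.Injective s) ×ˢ
            (Finset.univ.filter fun s : ι → Fin N => Function.Injective s),
            if ∃ a b c d, a ≠ b ∧ st.1 a = st.2 c ∧ st.1 b = st.2 d then M ^ 2 else 0 := by
            refine Finset.sum_le_sum fun st hst => ?_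
            simp only [Finset.mem_product, Finset.mem_filter, Finset.mem_univ, true_and] at hst
            split_ifs with h
            · exact hle st
            · exact (integral_mul_eq_zero_of_degenerate μ hψ hdeg hst.1 h).le
        _ ≤ ∑ st : (ι → Fin N) × (ι → Fin N),
            if ∃ a b c d, a ≠ b ∧ st.1 a = st.2 c ∧ st.1 b = st.2 d then M ^ 2 else 0 :=
            Finset.sum_le_sum_of_subset_of_nonneg (Finset.subset_univ _) fun st _ _ => by
              split_ifs <;> positivity
        _ = _ := by
            rw [← Finset.sum_filter, Finset.sum_const, nsmul_eq_mul]
    rw [le_div_iff₀ (by positivity), one_div_mul_eq_div, div_mul_eq_mul_div,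
      div_le_iff₀ (by positivity)]
    calc _ ≤ _ * M ^ 2 * (N : ℝ) ^ 2 := mul_le_mul_of_nonneg_right hsum (by positivity)
      _ = _ * (N : ℝ) ^ 2 * M ^ 2 := by ring
      _ ≤ (m : ℝ) ^ 4 * ((N : ℝ) ^ m) ^ 2 * M ^ 2 :=
        mul_le_mul_of_nonneg_right hc' (by positivity)
      _ = _ := by ring
  calc ∫ x, vStat ψ x ^ 2 ∂ν ≤ ∫ x, (2 * A x ^ 2 + 2 * ((m : ℝ) ^ 2 * M / N) ^ 2) ∂ν := by
        refine integral_mono (((hψ.vStat N).pow 2).integrable ν)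
          ((((hA.pow 2).const_mul 2).add (IsBddMeas.const _)).integrable ν) fun x => ?_
        have := hB x
        simp only [hAB]
        nlinarith [sq_nonneg (A x - B x)]
    _ = 2 * ∫ x, A x ^ 2 ∂ν + 2 * ((m : ℝ) ^ 2 * M / N) ^ 2 := by
        rw [integral_add (((hA.pow 2).const_mul 2).integrable ν) (integrable_const _),
          integral_const_mul]
        simp
    _ ≤ 2 * ((m : ℝ) ^ 4 * M ^ 2 / (N : ℝ) ^ 2) + 2 * ((m : ℝ) ^ 2 * M / N) ^ 2 := by gcongr
    _ = _ := by ring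

-- Each n is the value s a of exactly N^(m-1) tuples, so the V-statistic of a one-variable kernel is
-- a sample mean.
omit [MeasurableSpace E] in
lemma vStat_eval {N : ℕ} (hN : 1 ≤ N) (a : ι) (f : E → ℝ) (x : Fin N → E) :
    vStat (fun z : ι → E => f (z a)) x = 1 / (N : ℝ) * ∑ n, f (x n) := by
  have hN0 : (N : ℝ) ≠ 0 := by exact_mod_cast (Nat.one_le_iff_ne_zero.1 hN)
  have hsum : ∑ s : ι → Fin N, f (x (s a)) = (∑ n, f (x n)) * (N : ℝ) ^ (Fintype.card ι - 1) := by
    -- With f in factor a and 1 in all others, distributing the product over the sums produces the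
    -- count N^(m-1).
    have h := Finset.prod_univ_sum (fun _ : ι => (Finset.univ : Finset (Fin N)))
      (fun b j => if b = a then f (x j) else 1)
    rw [Fintype.piFinset_univ] at h
    simp only [Finset.prod_ite_eq', Finset.mem_univ, if_true] at h
    rw [← h, ← Finset.mul_prod_erase Finset.univ _ (Finset.mem_univ a)]
    simp only [if_true]
    congr 1
    rw [Finset.prod_congr rfl (g := fun _ => (N : ℝ)), Finset.prod_const,
      Finset.card_erase_of_mem (Finset.mem_univ a), Finset.card_univ]
    intro b hb
    simp [Finset.ne_of_mem_erase hb]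
  have hcard : Fintype.card ι = Fintype.card ι - 1 + 1 :=
    (Nat.succ_pred_eq_of_pos (Fintype.card_pos_iff.2 ⟨a⟩)).symm
  rw [vStat, hsum]
  conv_lhs => rw [hcard]
  rw [Nat.add_sub_cancel, pow_succ]
  field_simp

omit [DecidableEq ι] in
lemma integral_comp_coord {f : E → ℝ} (hf : IsBddMeas f) (a : ι) :
    ∫ z : ι → E, f (z a) ∂Measure.pi (fun _ => μ) = ∫ t, f t ∂μ := by
  have hmp := measurePreserving_eval (fun _ : ι => μ) a
  have h := integral_map (μ := Measure.pi fun _ : ι => μ) (f := f) hmp.measurable.aemeasurable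
    hf.measurable.aestronglyMeasurable
  rw [hmp.map_eq] at h
  exact h.symm

/-- The tower property, obtained as resampling with the trivial cofactor 1. -/
lemma integral_kernelProj {φ : (ι → E) → ℝ} (hφ : IsBddMeas φ) (a : ι) :
    ∫ t, kernelProj μ φ a t ∂μ = ∫ z, φ z ∂Measure.pi fun _ => μ := by
  have h := integral_resample μ (J := ι) Function.injective_id a hφ (IsBddMeas.const 1)
    fun _ _ _ => rfl
  simp only [mul_one, id] at h
  rw [h, integral_comp_coord μ (hφ.kernelProj μ a)]

/-- The first order Hoeffding expansion of a V-statistic. -/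
lemma exists_integral_vStat_sub_sq_le [Nonempty ι] {φ : (ι → E) → ℝ} (hφ : IsBddMeas φ) :
    ∃ c C : ℝ, ∀ N : ℕ, 1 ≤ N →
      ∫ x, (vStat φ x - (c + 1 / (N : ℝ) * ∑ n, ∑ a, kernelProj μ φ a (x n))) ^ 2
        ∂Measure.pi (fun _ : Fin N => μ) ≤ C / (N : ℝ) ^ 2 := by
  set θ := ∫ z, φ z ∂Measure.pi fun _ : ι => μ
  let ψ : (ι → E) → ℝ := fun z => φ z - (θ + ∑ a, (kernelProj μ φ a (z a) - θ))
  have hterm : ∀ a, IsBddMeas fun t => kernelProj μ φ a t - θ := fun a =>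
    (hφ.kernelProj μ a).sub (IsBddMeas.const _)
  have hlin : IsBddMeas fun z : ι → E => θ + ∑ a, (kernelProj μ φ a (z a) - θ) :=
    (IsBddMeas.const θ).add (IsBddMeas.sum _ fun a _ => (hterm a).comp (measurable_pi_apply a))
  have hψ : IsBddMeas ψ := hφ.sub hlin
  have hdeg : ∀ a t, kernelProj μ ψ a t = 0 := by
    intro a t
    have hup : Measurable fun z : ι → E => Function.update z a t :=
      (measurable_update_prod a).comp (measurable_const.prodMk measurable_id)
    -- A centred projection in position b ≠ a averages to zero, so freezing position a leaves only
    -- the term b = a, which cancels the projection of φ itself.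
    have hone : ∀ b, ∫ z : ι → E, (kernelProj μ φ b (Function.update z a t b) - θ)
        ∂Measure.pi (fun _ => μ) = if b = a then kernelProj μ φ a t - θ else 0 := by
      intro b
      by_cases hb : b = a
      · subst hb; simp
      · simp only [Function.update_of_ne hb, if_neg hb]
        rw [integral_sub (((hφ.kernelProj μ b).comp (measurable_pi_apply b)).integrable _)
          (integrable_const _)]
        rw [integral_comp_coord μ (hφ.kernelProj μ b), integral_kernelProj μ hφ b]
        simp [θ]
    have hb : ∀ b, IsBddMeas fun z : ι → E => kernelProj μ φ b (Function.update z a t b) - θ :=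
      fun b => (hterm b).comp ((measurable_pi_apply b).comp hup)
    have key : kernelProj μ ψ a t = kernelProj μ φ a t - (θ +
        ∑ b, ∫ z : ι → E, (kernelProj μ φ b (Function.update z a t b) - θ)
          ∂Measure.pi (fun _ => μ)) := by
      rw [kernelProj]
      simp only [ψ]
      rw [integral_sub ((hφ.comp hup).integrable _) ((hlin.comp hup).integrable _),
        integral_add (integrable_const _) ((IsBddMeas.sum _ fun b _ => hb b).integrable _),
        integral_finsetSum _ fun b _ => (hb b).integrable _]
      simp [kernelProj]
    rw [key]
    simp [hone]
  obtain ⟨C, hC⟩ := integral_vStat_sq_le_of_degenerate μ hψ hdeg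
  -- Each of the m centred projections carries a -θ besides the mean θ. The constant has no effect
  -- on variances.
  refine ⟨θ - Fintype.card ι * θ, C, fun N hN => ?_⟩
  have hN0 : (N : ℝ) ≠ 0 := by exact_mod_cast (Nat.one_le_iff_ne_zero.1 hN)
  refine le_of_eq_of_le (integral_congr_ae (ae_of_all _ fun x => ?_)) (hC N hN)
  simp only
  congr 1
  have h1 : vStat ψ x = vStat φ x -
      (θ + ∑ a, (vStat (fun z : ι → E => kernelProj μ φ a (z a)) x - θ)) := by
    simp only [vStat, ψ, Finset.sum_sub_distrib, Finset.sum_add_distrib, mul_sub, mul_add,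
      Finset.sum_const, Finset.card_univ, Fintype.card_fun, Fintype.card_fin, nsmul_eq_mul,
      Nat.cast_pow]
    rw [Finset.sum_comm, ← Finset.mul_sum]
    field_simp
  rw [h1]
  simp only [vStat_eval hN, Finset.sum_sub_distrib, Finset.sum_const, Finset.card_univ,
    nsmul_eq_mul]
  rw [Finset.sum_comm (s := Finset.univ) (t := Finset.univ), Finset.mul_sum]
  ring

end Hoeffding

/-! ### From an L² linearization to the variance -/

section VarianceExpansion

/-- Nonnegativity of var(εA ± R) bounds 2|cov(A, R)| by ε var A + ε⁻¹ var R. The free ε lets the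
first part be absorbed into o(1/N). -/
lemma abs_variance_add_sub_le {Ω : Type*} [MeasurableSpace Ω] {P : Measure Ω}
    [IsProbabilityMeasure P] {A R : Ω → ℝ} (hA : MemLp A 2 P) (hR : MemLp R 2 P) {ε : ℝ}
    (hε : 0 < ε) :
    |variance (fun ω => A ω + R ω) P - variance A P| ≤
      ε * variance A P + (1 + ε⁻¹) * variance R P := by
  have hεA : MemLp (fun ω => ε * A ω) 2 P := hA.const_mul ε
  have h1 := variance_nonneg (fun ω => ε * A ω + R ω) P
  have h2 := variance_nonneg (fun ω => ε * A ω - R ω) P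
  rw [variance_fun_add hεA hR, variance_const_mul, covariance_const_mul_left] at h1
  rw [variance_fun_sub hεA hR, variance_const_mul, covariance_const_mul_left] at h2
  rw [variance_fun_add hA hR]
  have hV := variance_nonneg R P
  have e : ε⁻¹ * variance R P = variance R P / ε := by ring
  have b1 : -(2 * covariance A R P) ≤ ε * variance A P + ε⁻¹ * variance R P := by
    rw [e, ← sub_le_iff_le_add', le_div_iff₀ hε]
    nlinarith
  have b2 : 2 * covariance A R P ≤ ε * variance A P + ε⁻¹ * variance R P := by
    rw [e, ← sub_le_iff_le_add', le_div_iff₀ hε]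
    nlinarith
  rw [abs_le]
  constructor <;> linarith

variable {E : Type*} [MeasurableSpace E] (μ : Measure E) [IsProbabilityMeasure μ]

/-- A statistic that is a sample mean up to an error of order `1/N` in mean square has the
variance of that sample mean up to `o(1/N)`. -/
lemma variance_sub_isLittleO {Q : (N : ℕ) → (Fin N → E) → ℝ} (hQ : ∀ N, IsBddMeas (Q N))
    {g : E → ℝ} (hg : IsBddMeas g) {c C : ℝ}
    (h : ∀ N : ℕ, 1 ≤ N → ∫ x, (Q N x - (c + 1 / (N : ℝ) * ∑ n, g (x n))) ^ 2
      ∂Measure.pi (fun _ : Fin N => μ) ≤ C / (N : ℝ) ^ 2) :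
    (fun N : ℕ => variance (Q N) (Measure.pi fun _ : Fin N => μ) - variance g μ / N)
      =o[atTop] fun N : ℕ => 1 / (N : ℝ) := by
  set v := variance g μ
  have hv : 0 ≤ v := variance_nonneg _ _
  rw [isLittleO_iff]
  intro δ hδ
  -- This makes ε v ≤ δ/2; the denominator uses v + 1 since v may vanish. The lower bound on N below
  -- makes the contribution of the error at most (δ/2)/N.
  set ε := δ / (2 * (v + 1))
  have hε : 0 < ε := by positivity
  have hεv : ε * v ≤ δ / 2 := by
    have : ε * (v + 1) = δ / 2 := by simp only [ε]; field_simp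
    nlinarith
  filter_upwards [eventually_ge_atTop 1,
    eventually_ge_atTop ⌈(1 + ε⁻¹) * C / (δ / 2)⌉₊] with N hN hN2
  have hN0 : (0 : ℝ) < N := by exact_mod_cast hN
  let A : (Fin N → E) → ℝ := fun x => c + 1 / (N : ℝ) * ∑ n, g (x n)
  let R : (Fin N → E) → ℝ := fun x => Q N x - A x
  have hS : IsBddMeas fun x : Fin N → E => ∑ n, g (x n) :=
    IsBddMeas.sum _ fun n _ => hg.comp (measurable_pi_apply n)
  have hA : IsBddMeas A := (IsBddMeas.const c).add (hS.const_mul _)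
  have hR : IsBddMeas R := (hQ N).sub hA
  have hVA : variance A (Measure.pi fun _ : Fin N => μ) = v / N := by
    simp only [A]
    rw [variance_const_add (hS.const_mul _).measurable.aestronglyMeasurable, variance_const_mul]
    have := variance_sum_pi (μ := fun _ : Fin N => μ) (X := fun _ => g) fun _ => hg.memLp μ 2
    have hfun : (∑ n : Fin N, fun x : Fin N → E => g (x n)) = fun x => ∑ n, g (x n) := by
      ext x; simp
    rw [hfun] at this
    rw [this]
    simp only [Finset.sum_const, Finset.card_univ, Fintype.card_fin, nsmul_eq_mul]
    field_simp
    rfl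
  have hVR : variance R (Measure.pi fun _ : Fin N => μ) ≤ C / (N : ℝ) ^ 2 :=
    (variance_le_expectation_sq hR.measurable.aestronglyMeasurable).trans (h N hN)
  have key := abs_variance_add_sub_le (hA.memLp (Measure.pi fun _ : Fin N => μ) 2)
    (hR.memLp _ 2) hε
  have hQAR : (fun x => A x + R x) = Q N := by
    ext x; simp [R]
  rw [hQAR, hVA] at key
  rw [Real.norm_eq_abs, Real.norm_eq_abs, abs_of_nonneg (by positivity : (0 : ℝ) ≤ 1 / N)]
  refine key.trans ?_
  have hlast : (1 + ε⁻¹) * (C / (N : ℝ) ^ 2) ≤ δ / 2 / N := by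
    have := (Nat.le_ceil _).trans (Nat.cast_le (α := ℝ).2 hN2)
    rw [div_le_iff₀ (by positivity)] at this
    rw [← mul_div_assoc, div_le_div_iff₀ (by positivity) hN0, pow_two]
    nlinarith
  calc ε * (v / N) + (1 + ε⁻¹) * variance R (Measure.pi fun _ : Fin N => μ)
      ≤ ε * (v / N) + (1 + ε⁻¹) * (C / (N : ℝ) ^ 2) := by gcongr
    _ ≤ δ / 2 / N + δ / 2 / N := by
        gcongr
        rw [← mul_div_assoc]
        gcongr
    _ = _ := by ring

end VarianceExpansion

/-! ### Boundedness, measurability and evenness of 𝒦₂ -/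

section Kernel

variable {𝒦 : ℝ → ℝ}

/-- The inequality 2|ab| ≤ a² + b² under the integral, together with translation invariance of ∫ 𝒦².
-/
lemma abs_mirrorConv_le (h𝒦 : MemLp 𝒦 2 volume) (u : ℝ) :
    |mirrorConv 𝒦 u| ≤ ∫ v, 𝒦 v ^ 2 := by
  have hsq : Integrable fun v => 𝒦 v ^ 2 := h𝒦.integrable_sq
  have hsq' : Integrable fun v => 𝒦 (u + v) ^ 2 := hsq.comp_add_left u
  have hb := norm_integral_le_of_norm_le (f := fun v => 𝒦 (u + v) * 𝒦 v)
    ((hsq'.add hsq).const_mul (1 / 2)) (ae_of_all _ fun v => by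
      rw [Real.norm_eq_abs, abs_le]
      simp only [Pi.add_apply]
      constructor <;> nlinarith [sq_nonneg (𝒦 (u + v) - 𝒦 v), sq_nonneg (𝒦 (u + v) + 𝒦 v)])
  rw [integral_const_mul] at hb
  simp only [Pi.add_apply] at hb
  rw [integral_add hsq' hsq, integral_add_left_eq_self (fun v => 𝒦 v ^ 2) u] at hb
  rw [mirrorConv, ← Real.norm_eq_abs]
  linarith

/-- 𝒦 is only a.e. equal to a measurable k. Translations preserve null sets, so passing to k changes
no value of the convolution, and parameter integrals of k are measurable. -/
lemma measurable_mirrorConv (h𝒦 : MemLp 𝒦 2 volume) : Measurable (mirrorConv 𝒦) := by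
  obtain ⟨k, hk, hae⟩ := h𝒦.1
  have heq : mirrorConv 𝒦 = mirrorConv k := by
    funext u
    have hshift : (fun v => 𝒦 (u + v)) =ᵐ[volume] fun v => k (u + v) :=
      (measurePreserving_add_left volume u).quasiMeasurePreserving.ae_eq_comp hae
    exact integral_congr_ae (hshift.mul hae)
  rw [heq]
  have hF : StronglyMeasurable fun p : ℝ × ℝ => k (p.1 + p.2) * k p.2 :=
    (hk.comp_measurable (measurable_fst.add measurable_snd)).mul (hk.comp_measurable measurable_snd)
  exact hF.integral_prod_right'.measurable

/-- The substitution v ↦ u + v exchanges the two factors. -/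
lemma mirrorConv_neg (u : ℝ) : mirrorConv 𝒦 (-u) = mirrorConv 𝒦 u := by
  unfold mirrorConv
  rw [← integral_add_left_eq_self (fun v => 𝒦 (-u + v) * 𝒦 v) u]
  refine integral_congr_ae (ae_of_all _ fun v => ?_)
  simp only [neg_add_cancel_left]
  ring

lemma isBddMeas_rescale_mirrorConv (h𝒦 : MemLp 𝒦 2 volume) (h : ℝ) :
    IsBddMeas (rescale (mirrorConv 𝒦) h) := by
  have hm : IsBddMeas (mirrorConv 𝒦) := ⟨measurable_mirrorConv h𝒦, _, abs_mirrorConv_le h𝒦⟩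
  have := (hm.comp (measurable_id.div_const h)).const_mul h⁻¹
  convert this using 2 with x
  rw [rescale, id, div_eq_inv_mul]

lemma rescale_mirrorConv_neg (h x : ℝ) :
    rescale (mirrorConv 𝒦) h (-x) = rescale (mirrorConv 𝒦) h x := by
  rw [rescale, rescale, neg_div, mirrorConv_neg]

end Kernel

/-! ### The three statistics as V-statistics -/

section Kernels

variable {K : ℕ} (κ : ℝ → ℝ) (σ : Fin K → ℝ)

/-- The kernel of `V1`. -/
def ker1 (z : Fin 2 → Fin K → ℝ) : ℝ := ∏ k, κ ((z 0 k - z 1 k) / σ k)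

/-- The kernel of `V2`. -/
def ker2 (z : Fin K ⊕ Fin K → Fin K → ℝ) : ℝ :=
  ∏ k, κ ((z (Sum.inl k) k - z (Sum.inr k) k) / σ k)

/-- The kernel of `V3`. -/
def ker3 (z : Fin (K + 1) → Fin K → ℝ) : ℝ :=
  ∏ k : Fin K, κ ((z k.castSucc k - z (Fin.last K) k) / σ k)

variable {κ}

lemma isBddMeas_prod_kernel {X : Type*} [MeasurableSpace X] (hκ : IsBddMeas κ) (s : Finset (Fin K))
    {u v : Fin K → X → ℝ} (hu : ∀ k, Measurable (u k)) (hv : ∀ k, Measurable (v k)) :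
    IsBddMeas fun x => ∏ k ∈ s, κ ((u k x - v k x) / σ k) :=
  IsBddMeas.prod _ fun k _ => hκ.comp (((hu k).sub (hv k)).div_const (σ k))

lemma measurable_coord_coord {I J : Type*} (i : I) (j : J) :
    Measurable fun z : I → J → ℝ => z i j :=
  (measurable_pi_apply j).comp (measurable_pi_apply i)

lemma isBddMeas_ker1 (hκ : IsBddMeas κ) : IsBddMeas (ker1 κ σ) :=
  isBddMeas_prod_kernel σ hκ _ (fun _ => measurable_coord_coord _ _)
    fun _ => measurable_coord_coord _ _

lemma isBddMeas_ker2 (hκ : IsBddMeas κ) : IsBddMeas (ker2 κ σ) :=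
  isBddMeas_prod_kernel σ hκ _ (fun _ => measurable_coord_coord _ _)
    fun _ => measurable_coord_coord _ _

lemma isBddMeas_ker3 (hκ : IsBddMeas κ) : IsBddMeas (ker3 κ σ) :=
  isBddMeas_prod_kernel σ hκ _ (fun _ => measurable_coord_coord _ _)
    fun _ => measurable_coord_coord _ _

lemma kernel_swap (heven : ∀ x, κ (-x) = κ x) (a b c : ℝ) : κ ((a - b) / c) = κ ((b - a) / c) := by
  rw [← heven, ← neg_div, neg_sub]

lemma V1_eq_vStat {N : ℕ} (y : Fin N → Fin K → ℝ) : V1 κ σ y = vStat (ker1 κ σ) y := by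
  have h : ∑ s : Fin 2 → Fin N, ker1 κ σ (fun a => y (s a)) =
      ∑ p : Fin N × Fin N, ∏ k, κ ((y p.1 k - y p.2 k) / σ k) :=
    Fintype.sum_equiv (finTwoArrowEquiv (Fin N)) _ _ fun s => rfl
  rw [vStat, h, Fintype.sum_prod_type]
  simp only [V1, piJointHat, sampleMean, ← Finset.mul_sum, Fintype.card_fin]
  ring

lemma V2_eq_vStat {N : ℕ} (y : Fin N → Fin K → ℝ) : V2 κ σ y = vStat (ker2 κ σ) y := by
  have h : ∑ s : Fin K ⊕ Fin K → Fin N, ker2 κ σ (fun a => y (s a)) =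
      ∑ p : (Fin K → Fin N) × (Fin K → Fin N), ∏ k, κ ((y (p.1 k) k - y (p.2 k) k) / σ k) :=
    Fintype.sum_equiv (Equiv.sumArrowEquivProdArrow _ _ _) _ _ fun s => rfl
  rw [vStat, h, Fintype.sum_prod_type]
  simp only [V2, piMargHat, sampleMean, ← Finset.mul_sum, Finset.prod_mul_distrib,
    Finset.prod_const, Finset.card_univ, Fintype.card_fin, Fintype.card_sum]
  rw [Finset.prod_univ_sum, Fintype.piFinset_univ]
  simp only [Finset.prod_univ_sum, Fintype.piFinset_univ]
  ring

/-- The product over k of sample means becomes a sum over K-tuples. Evenness is needed because `V3`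
has the shared index first in each difference and `ker3` has it last. -/
lemma V3_eq_vStat (heven : ∀ x, κ (-x) = κ x) {N : ℕ} (y : Fin N → Fin K → ℝ) :
    V3 κ σ y = vStat (ker3 κ σ) y := by
  have h : ∑ s : Fin (K + 1) → Fin N, ker3 κ σ (fun a => y (s a)) =
      ∑ p : Fin N × (Fin K → Fin N), ∏ k, κ ((y p.1 k - y (p.2 k) k) / σ k) := by
    refine (Fintype.sum_equiv (Fin.snocEquiv fun _ : Fin (K + 1) => Fin N) _ _ fun p => ?_).symm
    simp only [ker3, Fin.snocEquiv_apply, Fin.snoc_castSucc, Fin.snoc_last]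
    exact Finset.prod_congr rfl fun k _ => kernel_swap heven _ _ _
  rw [vStat, h, Fintype.sum_prod_type]
  simp only [V3, piMargHat, sampleMean, Finset.prod_mul_distrib, ← Finset.mul_sum,
    Finset.prod_const, Finset.card_univ, Fintype.card_fin, Finset.prod_univ_sum,
    Fintype.piFinset_univ]
  ring

end Kernels

/-! ### Explicit first order projections -/

section Projections

variable {K : ℕ} {κ : ℝ → ℝ} (σ : Fin K → ℝ) (μ : Measure (Fin K → ℝ)) [IsProbabilityMeasure μ]

/-- The K pairs of variables are disjoint, so the factors are independent. As f may depend on k, one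
entry can be frozen, which is how the projections of `ker2` are computed. -/
lemma integral_prod_sum_pairs {E : Type*} [MeasurableSpace E] (ν : Measure E)
    [IsProbabilityMeasure ν] {f : Fin K → E × E → ℝ} (hf : ∀ k, IsBddMeas (f k)) :
    ∫ z : Fin K ⊕ Fin K → E, ∏ k, f k (z (Sum.inl k), z (Sum.inr k)) ∂Measure.pi (fun _ => ν) =
      ∏ k, ∫ u, ∫ v, f k (u, v) ∂ν ∂ν := by
  have hmp := measurePreserving_sumPiEquivProdPi fun _ : Fin K ⊕ Fin K => ν
  have hF : IsBddMeas fun p : (Fin K → E) × (Fin K → E) => ∏ k, f k (p.1 k, p.2 k) :=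
    IsBddMeas.prod _ fun k _ => (hf k).comp
      (((measurable_pi_apply k).comp measurable_fst).prodMk
        ((measurable_pi_apply k).comp measurable_snd))
  have h := hmp.integral_comp' fun p : (Fin K → E) × (Fin K → E) => ∏ k, f k (p.1 k, p.2 k)
  rw [integral_prod _ (hF.integrable _)] at h
  refine h.trans ?_
  rw [← integral_fintype_prod_eq_prod (fun k u => ∫ v, f k (u, v) ∂ν)]
  exact integral_congr_ae (ae_of_all _ fun u =>
    integral_fintype_prod_eq_prod fun k v => f k (u k, v))

/-- Given the shared last variable the factors are independent; the projections of `ker3` follow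
from this. -/
lemma integral_prod_last_pairs {E : Type*} [MeasurableSpace E] (ν : Measure E)
    [IsProbabilityMeasure ν] {f : Fin K → E × E → ℝ} (hf : ∀ k, IsBddMeas (f k)) :
    ∫ z : Fin (K + 1) → E, ∏ k : Fin K, f k (z k.castSucc, z (Fin.last K))
        ∂Measure.pi (fun _ => ν) =
      ∫ w, ∏ k, ∫ u, f k (u, w) ∂ν ∂ν := by
  have hmp := measurePreserving_piFinSuccAbove (fun _ : Fin (K + 1) => ν) (Fin.last K)
  have hF : IsBddMeas fun p : E × (Fin K → E) => ∏ k, f k (p.2 k, p.1) :=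
    IsBddMeas.prod _ fun k _ => (hf k).comp
      (((measurable_pi_apply k).comp measurable_snd).prodMk measurable_fst)
  have h := hmp.integral_comp' fun p : E × (Fin K → E) => ∏ k, f k (p.2 k, p.1)
  rw [integral_prod _ (hF.integrable _)] at h
  refine Eq.trans ?_ (h.trans ?_)
  · refine integral_congr_ae (ae_of_all _ fun z => ?_)
    simp [MeasurableEquiv.piFinSuccAbove, Fin.init]
  · exact integral_congr_ae (ae_of_all _ fun w =>
      integral_fintype_prod_eq_prod fun k u => f k (u, w))

lemma isBddMeas_pair_kernel (hκ : IsBddMeas κ) (k : Fin K)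
    {u v : (Fin K → ℝ) × (Fin K → ℝ) → Fin K → ℝ} (hu : Measurable u) (hv : Measurable v) :
    IsBddMeas fun p => κ ((u p k - v p k) / σ k) :=
  hκ.comp ((((measurable_pi_apply k).comp hu).sub ((measurable_pi_apply k).comp hv)).div_const _)

lemma isBddMeas_piJoint (hκ : IsBddMeas κ) : IsBddMeas (piJoint κ σ μ) :=
  (isBddMeas_prod_kernel (X := (Fin K → ℝ) × (Fin K → ℝ)) σ hκ Finset.univ
    (u := fun k p => p.1 k) (v := fun k p => p.2 k)
    (fun k => (measurable_pi_apply k).comp measurable_fst)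
    fun k => (measurable_pi_apply k).comp measurable_snd).integral_right μ

lemma isBddMeas_piMarg (hκ : IsBddMeas κ) (k : Fin K) : IsBddMeas (piMarg κ σ μ k) :=
  (hκ.comp (u := fun p : ℝ × (Fin K → ℝ) => (p.1 - p.2 k) / σ k)
    (by fun_prop)).integral_right μ

lemma isBddMeas_piMarg_coord (hκ : IsBddMeas κ) (k : Fin K) :
    IsBddMeas fun y : Fin K → ℝ => piMarg κ σ μ k (y k) :=
  (isBddMeas_piMarg σ μ hκ k).comp (measurable_pi_apply k)

lemma isBddMeas_piTilde (hκ : IsBddMeas κ) (l : Fin K) : IsBddMeas (piTilde κ σ μ l) :=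
  (((IsBddMeas.prod (Finset.univ.erase l) fun k _ => isBddMeas_piMarg_coord σ μ hκ k).comp
    (u := fun p : ℝ × (Fin K → ℝ) => p.2) measurable_snd).mul
    (hκ.comp (u := fun p : ℝ × (Fin K → ℝ) => (p.2 l - p.1) / σ l)
      (by fun_prop))).integral_right μ

lemma isBddMeas_piTilde_coord (hκ : IsBddMeas κ) (k : Fin K) :
    IsBddMeas fun y : Fin K → ℝ => piTilde κ σ μ k (y k) :=
  (isBddMeas_piTilde σ μ hκ k).comp (measurable_pi_apply k)

omit [IsProbabilityMeasure μ] in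
lemma piMarg_eq_swap (heven : ∀ x, κ (-x) = κ x) (k : Fin K) (t : ℝ) :
    piMarg κ σ μ k t = ∫ u, κ ((u k - t) / σ k) ∂μ :=
  integral_congr_ae (ae_of_all _ fun _ => kernel_swap heven _ _ _)

lemma kernelProj_ker1 (hκ : IsBddMeas κ) (heven : ∀ x, κ (-x) = κ x) (a : Fin 2)
    (t : Fin K → ℝ) : kernelProj μ (ker1 κ σ) a t = piJoint κ σ μ t := by
  have hb : IsBddMeas fun x : Fin K → ℝ => ∏ k, κ ((t k - x k) / σ k) :=
    isBddMeas_prod_kernel σ hκ Finset.univ (fun _ => measurable_const)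
      fun k => measurable_pi_apply k
  fin_cases a
  · exact integral_comp_coord μ hb (1 : Fin 2)
  · refine Eq.trans ?_ (integral_comp_coord μ hb (0 : Fin 2))
    refine integral_congr_ae (ae_of_all _ fun z => Finset.prod_congr rfl fun k _ => ?_)
    exact kernel_swap heven _ _ _

lemma kernelProj_ker2_inl (hκ : IsBddMeas κ) (l : Fin K) (t : Fin K → ℝ) :
    kernelProj μ (ker2 κ σ) (Sum.inl l) t = prodMeanExcept κ σ μ l * piMarg κ σ μ l (t l) := by
  have h := integral_prod_sum_pairs μ (f := fun k (p : (Fin K → ℝ) × (Fin K → ℝ)) =>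
      κ (((if k = l then t else p.1) k - p.2 k) / σ k)) fun k =>
    isBddMeas_pair_kernel σ hκ k (u := fun p => if k = l then t else p.1)
      (by split_ifs; exacts [measurable_const, measurable_fst]) measurable_snd
  refine Eq.trans ?_ (h.trans ?_)
  · refine integral_congr_ae (ae_of_all _ fun z => Finset.prod_congr rfl fun k _ => ?_)
    by_cases hk : k = l
    · subst hk; simp
    · simp [hk]
  · rw [← Finset.prod_erase_mul Finset.univ _ (Finset.mem_univ l), prodMeanExcept]
    congr 1
    · refine Finset.prod_congr rfl fun k hk => ?_
      simp only [if_neg (Finset.ne_of_mem_erase hk), piMarg]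
    · simp [piMarg]

lemma kernelProj_ker2_inr (hκ : IsBddMeas κ) (heven : ∀ x, κ (-x) = κ x) (l : Fin K)
    (t : Fin K → ℝ) :
    kernelProj μ (ker2 κ σ) (Sum.inr l) t = prodMeanExcept κ σ μ l * piMarg κ σ μ l (t l) := by
  have h := integral_prod_sum_pairs μ (f := fun k (p : (Fin K → ℝ) × (Fin K → ℝ)) =>
      κ ((p.1 k - (if k = l then t else p.2) k) / σ k)) fun k =>
    isBddMeas_pair_kernel σ hκ k (v := fun p => if k = l then t else p.2) measurable_fst
      (by split_ifs; exacts [measurable_const, measurable_snd])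
  refine Eq.trans ?_ (h.trans ?_)
  · refine integral_congr_ae (ae_of_all _ fun z => Finset.prod_congr rfl fun k _ => ?_)
    by_cases hk : k = l
    · subst hk; simp
    · simp [hk]
  · rw [← Finset.prod_erase_mul Finset.univ _ (Finset.mem_univ l), prodMeanExcept]
    congr 1
    · refine Finset.prod_congr rfl fun k hk => ?_
      simp only [if_neg (Finset.ne_of_mem_erase hk), piMarg]
    · simp [piMarg_eq_swap σ μ heven]

/-- Conditionally on the shared observation w, each factor k ≠ l averages to π_k(w_k) and the frozen
factor l stays. Averaging over w gives π̃_l. -/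
lemma kernelProj_ker3_castSucc (hκ : IsBddMeas κ) (heven : ∀ x, κ (-x) = κ x) (l : Fin K)
    (t : Fin K → ℝ) :
    kernelProj μ (ker3 κ σ) l.castSucc t = piTilde κ σ μ l (t l) := by
  have h := integral_prod_last_pairs μ (f := fun k (p : (Fin K → ℝ) × (Fin K → ℝ)) =>
      κ (((if k = l then t else p.1) k - p.2 k) / σ k)) fun k =>
    isBddMeas_pair_kernel σ hκ k (u := fun p => if k = l then t else p.1)
      (by split_ifs; exacts [measurable_const, measurable_fst]) measurable_snd
  refine Eq.trans ?_ (h.trans ?_)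
  · refine integral_congr_ae (ae_of_all _ fun z => Finset.prod_congr rfl fun k _ => ?_)
    by_cases hk : k = l
    · subst hk; simp [Function.update_of_ne (Fin.castSucc_ne_last k).symm]
    · simp [hk, Function.update_of_ne (Fin.castSucc_ne_last l).symm]
  · refine integral_congr_ae (ae_of_all _ fun w => ?_)
    simp only
    rw [← Finset.prod_erase_mul Finset.univ _ (Finset.mem_univ l)]
    congr 1
    · refine Finset.prod_congr rfl fun k hk => ?_
      simp only [if_neg (Finset.ne_of_mem_erase hk), piMarg_eq_swap σ μ heven]
    · simp [kernel_swap heven (t l)]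

lemma kernelProj_ker3_last (hκ : IsBddMeas κ) (heven : ∀ x, κ (-x) = κ x) (t : Fin K → ℝ) :
    kernelProj μ (ker3 κ σ) (Fin.last K) t = ∏ k, piMarg κ σ μ k (t k) := by
  have h := integral_prod_last_pairs μ (f := fun k (p : (Fin K → ℝ) × (Fin K → ℝ)) =>
      κ ((p.1 k - t k) / σ k)) fun k =>
    isBddMeas_pair_kernel σ hκ k measurable_fst (v := fun _ => t) measurable_const
  refine Eq.trans ?_ (h.trans ?_)
  · refine integral_congr_ae (ae_of_all _ fun z => Finset.prod_congr rfl fun k _ => ?_)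
    simp [Fin.castSucc_ne_last]
  · simp [piMarg_eq_swap σ μ heven]

end Projections

/-! ### U-statistics and remainders -/

section Decomposition

variable {K : ℕ} {κ : ℝ → ℝ} (σ : Fin K → ℝ)

lemma sum_sum_eq_diag_add_two_mul {N : ℕ} {f : Fin N → Fin N → ℝ} (hf : ∀ i j, f i j = f j i) :
    ∑ i, ∑ j, f i j = ∑ i, f i i + 2 * ∑ i, ∑ j ∈ Finset.Ioi i, f i j := by
  have hsplit : ∀ i, ∑ j, f i j =
      f i i + ∑ j ∈ Finset.Ioi i, f i j + ∑ j ∈ Finset.Iio i, f i j := by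
    intro i
    have h1 : (Finset.univ : Finset (Fin N)) = insert i (Finset.Ioi i ∪ Finset.Iio i) := by
      ext j
      simp only [Finset.mem_univ, Finset.mem_insert, Finset.mem_union, Finset.mem_Ioi,
        Finset.mem_Iio, true_iff]
      rcases lt_trichotomy j i with h | h | h <;> simp [h]
    have h2 : Disjoint (Finset.Ioi i) (Finset.Iio i) := by
      rw [Finset.disjoint_left]
      intro j hj hj'
      exact lt_asymm (Finset.mem_Ioi.1 hj) (Finset.mem_Iio.1 hj')
    rw [h1, Finset.sum_insert (by simp), Finset.sum_union h2, add_assoc]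
  have hswap : ∑ i, ∑ j ∈ Finset.Iio i, f i j = ∑ i, ∑ j ∈ Finset.Ioi i, f i j := by
    rw [Finset.sum_comm' (t' := Finset.univ) (s' := fun j => Finset.Ioi j) (by simp)]
    exact Finset.sum_congr rfl fun i _ => Finset.sum_congr rfl fun j _ => hf j i
  simp only [hsplit, Finset.sum_add_distrib, hswap]
  ring

lemma V1_decomposition (heven : ∀ x, κ (-x) = κ x) {N : ℕ} (hN : 1 ≤ N)
    (y : Fin N → Fin K → ℝ) :
    V1 κ σ y = ((N : ℝ) - 1) / N * U1 κ σ y + b1 K N κ / √(N : ℝ) := by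
  have hN0 : (0 : ℝ) < N := by exact_mod_cast hN
  have hsum := sum_sum_eq_diag_add_two_mul (f := fun i j : Fin N =>
    ∏ k, κ ((y i k - y j k) / σ k)) fun i j => Finset.prod_congr rfl fun k _ =>
      kernel_swap heven _ _ _
  have hV : V1 κ σ y = 1 / (N : ℝ) ^ 2 * ∑ i, ∑ j, ∏ k, κ ((y i k - y j k) / σ k) := by
    simp only [V1, piJointHat, sampleMean, ← Finset.mul_sum]
    ring
  have hb : b1 K N κ / √(N : ℝ) = 1 / (N : ℝ) * κ 0 ^ K := by
    simp only [b1, Finset.prod_const, Finset.card_univ, Fintype.card_fin]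
    rw [mul_comm, mul_div_assoc, div_div, Real.mul_self_sqrt hN0.le]
    ring
  rw [hV, hsum, hb, U1]
  simp only [sub_self, zero_div, Finset.prod_const, Finset.sum_const, Finset.card_univ,
    Fintype.card_fin, nsmul_eq_mul]
  -- For N = 1 the prefactor of `U1` divides by zero, but (N - 1)/N = 0 removes that term and only
  -- the diagonal remains.
  rcases Nat.eq_or_lt_of_le hN with h1 | h1
  · subst h1
    simp
  · have : (N : ℝ) - 1 ≠ 0 := by
      have : (1 : ℝ) < N := by exact_mod_cast h1
      linarith
    field_simp
    ring

/-- Splitting off the tuples with a repeated entry from a V-statistic. -/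
lemma vStat_decomposition {ι E : Type*} [Fintype ι] [DecidableEq ι] {N : ℕ} (hN : 1 ≤ N) {m : ℕ}
    (hm : Fintype.card ι = m) (φ : (ι → E) → ℝ) (y : Fin N → E) :
    vStat φ y = (N.choose m * m.factorial : ℝ) / (N : ℝ) ^ m *
        (1 / (N.descFactorial m : ℝ) *
          ∑ s : ι → Fin N with Function.Injective s, φ fun a => y (s a)) +
      √(N : ℝ) / (N : ℝ) ^ m *
        (∑ s : ι → Fin N with ¬ Function.Injective s, φ fun a => y (s a)) / √(N : ℝ) := by
  have hN0 : (0 : ℝ) < N := by exact_mod_cast hN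
  have hsq : √(N : ℝ) ≠ 0 := (Real.sqrt_pos.2 hN0).ne'
  have hdesc : (N.choose m * m.factorial : ℝ) = (N.descFactorial m : ℝ) := by
    rw [Nat.descFactorial_eq_factorial_mul_choose]
    push_cast
    ring
  have hinj : (N.descFactorial m : ℝ) * (1 / (N.descFactorial m : ℝ) *
      ∑ s : ι → Fin N with Function.Injective s, φ fun a => y (s a)) =
      ∑ s : ι → Fin N with Function.Injective s, φ fun a => y (s a) := by
    -- A zero count means N < m: there is no injective tuple, and both sides vanish.
    by_cases h0 : N.descFactorial m = 0
    · have hlt : N < m := Nat.descFactorial_eq_zero_iff_lt.1 h0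
      have hempty : (Finset.univ.filter fun s : ι → Fin N => Function.Injective s) = ∅ := by
        refine Finset.filter_eq_empty_iff.2 fun s _ hs => ?_
        have := Fintype.card_le_of_injective s hs
        rw [hm, Fintype.card_fin] at this
        omega
      rw [hempty]
      simp
    · have : (N.descFactorial m : ℝ) ≠ 0 := by exact_mod_cast h0
      field_simp
  rw [hdesc, div_mul_eq_mul_div, hinj, vStat, hm,
    ← Finset.sum_filter_add_sum_filter_not Finset.univ fun s : ι → Fin N => Function.Injective s]
  field_simp

lemma V2_decomposition {N : ℕ} (hN : 1 ≤ N) (y : Fin N → Fin K → ℝ) :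
    V2 κ σ y = (N.choose (2 * K) * (2 * K).factorial : ℝ) / (N : ℝ) ^ (2 * K) * U2 κ σ y +
      b2 κ σ y / √(N : ℝ) := by
  rw [V2_eq_vStat]
  exact vStat_decomposition hN (by simp [two_mul]) (ker2 κ σ) y

lemma V3_decomposition (heven : ∀ x, κ (-x) = κ x) {N : ℕ} (hN : 1 ≤ N)
    (y : Fin N → Fin K → ℝ) :
    V3 κ σ y = (N.choose (K + 1) * (K + 1).factorial : ℝ) / (N : ℝ) ^ (K + 1) * U3 κ σ y +
      b3 κ σ y / √(N : ℝ) := by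
  rw [V3_eq_vStat σ heven]
  exact vStat_decomposition hN (by simp) (ker3 κ σ) y

lemma sqrt_div_pow_mul_div_sqrt {N : ℕ} (hN : 1 ≤ N) (m : ℕ) (x : ℝ) :
    √(N : ℝ) / (N : ℝ) ^ m * x / √(N : ℝ) = 1 / (N : ℝ) ^ m * x := by
  have hsq : √(N : ℝ) ≠ 0 := (Real.sqrt_pos.2 (by exact_mod_cast hN)).ne'
  field_simp

lemma abs_b1_div_sqrt_le (N : ℕ) : |b1 K N κ / √(N : ℝ)| ≤ |κ 0 ^ K| / N := by
  simp only [b1, Finset.prod_const, Finset.card_univ, Fintype.card_fin]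
  rw [mul_comm, mul_div_assoc, div_div, Real.mul_self_sqrt N.cast_nonneg, abs_mul,
    abs_of_nonneg (by positivity : (0 : ℝ) ≤ 1 / N), mul_one_div]

lemma exists_abs_b2_div_sqrt_le (hκ : IsBddMeas κ) :
    ∃ C, ∀ N : ℕ, 1 ≤ N → ∀ y : Fin N → Fin K → ℝ, |b2 κ σ y / √(N : ℝ)| ≤ C / N := by
  obtain ⟨M, hM⟩ := (isBddMeas_ker2 σ hκ).bounded
  refine ⟨_, fun N hN y => le_of_eq_of_le ?_ (abs_sum_not_injective_le hN
    (f := fun s : Fin K ⊕ Fin K → Fin N => ker2 κ σ fun a => y (s a)) fun s => hM _)⟩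
  rw [b2, sqrt_div_pow_mul_div_sqrt hN, Fintype.card_sum, Fintype.card_fin, two_mul]
  rfl

lemma exists_abs_b3_div_sqrt_le (hκ : IsBddMeas κ) :
    ∃ C, ∀ N : ℕ, 1 ≤ N → ∀ y : Fin N → Fin K → ℝ, |b3 κ σ y / √(N : ℝ)| ≤ C / N := by
  obtain ⟨M, hM⟩ := (isBddMeas_ker3 σ hκ).bounded
  refine ⟨_, fun N hN y => le_of_eq_of_le ?_ (abs_sum_not_injective_le hN
    (f := fun s : Fin (K + 1) → Fin N => ker3 κ σ fun a => y (s a)) fun s => hM _)⟩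
  rw [b3, sqrt_div_pow_mul_div_sqrt hN, Fintype.card_fin]
  rfl

lemma isBddMeas_b2 (hκ : IsBddMeas κ) (N : ℕ) :
    IsBddMeas fun y : Fin N → Fin K → ℝ => b2 κ σ y :=
  (IsBddMeas.sum _ fun s _ => (isBddMeas_ker2 σ hκ).comp (measurable_precomp s)).const_mul _

lemma isBddMeas_b3 (hκ : IsBddMeas κ) (N : ℕ) :
    IsBddMeas fun y : Fin N → Fin K → ℝ => b3 κ σ y :=
  (IsBddMeas.sum _ fun s _ => (isBddMeas_ker3 σ hκ).comp (measurable_precomp s)).const_mul _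

lemma sq_le_of_abs_div_sqrt_le {N : ℕ} (hN : 1 ≤ N) {b C : ℝ} (h : |b / √(N : ℝ)| ≤ C / N) :
    b ^ 2 ≤ C ^ 2 / N := by
  have hN0 : (0 : ℝ) < N := by exact_mod_cast hN
  have h2 := pow_le_pow_left₀ (abs_nonneg _) h 2
  rw [sq_abs, div_pow, Real.sq_sqrt hN0.le, div_le_iff₀ hN0] at h2
  refine h2.trans_eq ?_
  field_simp

lemma tendsto_integral_sq_zero {Ω : Type*} [MeasurableSpace Ω] {P : Measure Ω}
    [IsProbabilityMeasure P] {b : ℕ → Ω → ℝ} (hb : ∀ N, MemLp (b N) 2 P) {C : ℝ}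
    (h : ∀ N : ℕ, 1 ≤ N → ∀ ω, |b N ω / √(N : ℝ)| ≤ C / N) :
    Tendsto (fun N => ∫ ω, b N ω ^ 2 ∂P) atTop (𝓝 0) := by
  refine tendsto_of_tendsto_of_tendsto_of_le_of_le' tendsto_const_nhds
    (tendsto_const_div_atTop_nhds_zero_nat (C ^ 2))
    (Eventually.of_forall fun N => integral_nonneg fun ω => sq_nonneg _) ?_
  filter_upwards [eventually_ge_atTop 1] with N hN
  calc ∫ ω, b N ω ^ 2 ∂P ≤ ∫ _ω, C ^ 2 / (N : ℝ) ∂P :=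
        integral_mono (hb N).integrable_sq (integrable_const _) fun ω =>
          sq_le_of_abs_div_sqrt_le hN (h N hN ω)
    _ = C ^ 2 / N := by simp

end Decomposition

/-! ### Linearization of Q̂ and the covariances of its linear part -/

section Variance

variable {K : ℕ} {κ : ℝ → ℝ} (σ : Fin K → ℝ) (μ : Measure (Fin K → ℝ)) [IsProbabilityMeasure μ]

lemma isBddMeas_QHat (hκ : IsBddMeas κ) (heven : ∀ x, κ (-x) = κ x) (N : ℕ) :
    IsBddMeas fun y : Fin N → Fin K → ℝ => QHat κ σ y := by
  simp only [QHat, V1_eq_vStat, V2_eq_vStat, V3_eq_vStat σ heven]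
  exact (((isBddMeas_ker1 σ hκ).vStat N).add ((isBddMeas_ker2 σ hκ).vStat N)).sub
    (((isBddMeas_ker3 σ hκ).vStat N).const_mul 2)

variable (κ)

/-- Half the linear part of `V2`. -/
def linPart2 (y : Fin K → ℝ) : ℝ := ∑ l, prodMeanExcept κ σ μ l * piMarg κ σ μ l (y l)

/-- The linear part of `V3`. -/
def linPart3 (y : Fin K → ℝ) : ℝ := ∏ k, piMarg κ σ μ k (y k) + ∑ l, piTilde κ σ μ l (y l)

variable {κ}

lemma isBddMeas_linPart2 (hκ : IsBddMeas κ) : IsBddMeas (linPart2 κ σ μ) :=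
  IsBddMeas.sum _ fun l _ => (isBddMeas_piMarg_coord σ μ hκ l).const_mul _

lemma isBddMeas_prod_piMarg (hκ : IsBddMeas κ) :
    IsBddMeas fun y : Fin K → ℝ => ∏ k, piMarg κ σ μ k (y k) :=
  IsBddMeas.prod _ fun k _ => isBddMeas_piMarg_coord σ μ hκ k

lemma isBddMeas_sum_piTilde (hκ : IsBddMeas κ) :
    IsBddMeas fun y : Fin K → ℝ => ∑ l, piTilde κ σ μ l (y l) :=
  IsBddMeas.sum _ fun l _ => isBddMeas_piTilde_coord σ μ hκ l

lemma isBddMeas_linPart3 (hκ : IsBddMeas κ) : IsBddMeas (linPart3 κ σ μ) :=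
  (isBddMeas_prod_piMarg σ μ hκ).add (isBddMeas_sum_piTilde σ μ hκ)

/-- The three Hoeffding expansions are added with weights 1, 1, -2. The 2 before `piJoint` and
`linPart2` counts the two symmetric positions of each pair; `ker3` has no such symmetry. -/
lemma QHat_linearization (hK : 1 ≤ K) (hκ : IsBddMeas κ) (heven : ∀ x, κ (-x) = κ x) :
    ∃ c C : ℝ, ∀ N : ℕ, 1 ≤ N →
      ∫ y, (QHat κ σ y - (c + 1 / (N : ℝ) * ∑ n,
          (2 * piJoint κ σ μ (y n) + 2 * linPart2 κ σ μ (y n) - 2 * linPart3 κ σ μ (y n)))) ^ 2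
        ∂Measure.pi (fun _ : Fin N => μ) ≤ C / (N : ℝ) ^ 2 := by
  have : Nonempty (Fin K ⊕ Fin K) := ⟨Sum.inl ⟨0, hK⟩⟩
  obtain ⟨c1, C1, h1⟩ := exists_integral_vStat_sub_sq_le μ (isBddMeas_ker1 σ hκ)
  obtain ⟨c2, C2, h2⟩ := exists_integral_vStat_sub_sq_le μ (isBddMeas_ker2 σ hκ)
  obtain ⟨c3, C3, h3⟩ := exists_integral_vStat_sub_sq_le μ (isBddMeas_ker3 σ hκ)
  have e1 : ∀ t, ∑ a, kernelProj μ (ker1 κ σ) a t = 2 * piJoint κ σ μ t := fun t => by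
    simp [kernelProj_ker1 σ μ hκ heven]
  have e2 : ∀ t, ∑ a, kernelProj μ (ker2 κ σ) a t = 2 * linPart2 κ σ μ t := fun t => by
    simp only [Fintype.sum_sum_type, kernelProj_ker2_inl σ μ hκ,
      kernelProj_ker2_inr σ μ hκ heven, linPart2]
    ring
  have e3 : ∀ t, ∑ a, kernelProj μ (ker3 κ σ) a t = linPart3 κ σ μ t := fun t => by
    simp only [Fin.sum_univ_castSucc, kernelProj_ker3_castSucc σ μ hκ heven,
      kernelProj_ker3_last σ μ hκ heven, linPart3]
    ring
  simp only [e1] at h1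
  simp only [e2] at h2
  simp only [e3] at h3
  refine ⟨c1 + c2 - 2 * c3, 3 * C1 + 3 * C2 + 12 * C3, fun N hN => ?_⟩
  have hJ := isBddMeas_piJoint σ μ hκ
  have hL2 := isBddMeas_linPart2 σ μ hκ
  have hL3 := isBddMeas_linPart3 σ μ hκ
  have hres : ∀ {ι : Type} [Fintype ι] [DecidableEq ι] {φ : (ι → Fin K → ℝ) → ℝ}
      {g : (Fin K → ℝ) → ℝ} (c : ℝ), IsBddMeas φ → IsBddMeas g →
      IsBddMeas fun y : Fin N → Fin K → ℝ =>
        (vStat φ y - (c + 1 / (N : ℝ) * ∑ n, g (y n))) ^ 2 := fun c hφ hg =>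
    ((hφ.vStat N).sub ((IsBddMeas.const c).add ((IsBddMeas.sum _ fun n _ =>
      hg.comp (measurable_pi_apply n)).const_mul _))).pow 2
  have b1 := hres c1 (isBddMeas_ker1 σ hκ) (hJ.const_mul 2)
  have b2 := hres c2 (isBddMeas_ker2 σ hκ) (hL2.const_mul 2)
  have b3 := hres c3 (isBddMeas_ker3 σ hκ) hL3
  have hg := ((hJ.const_mul 2).add (hL2.const_mul 2)).sub (hL3.const_mul 2)
  have b0 : IsBddMeas fun y : Fin N → Fin K → ℝ => (QHat κ σ y - (c1 + c2 - 2 * c3 +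
      1 / (N : ℝ) * ∑ n, (2 * piJoint κ σ μ (y n) + 2 * linPart2 κ σ μ (y n)
        - 2 * linPart3 κ σ μ (y n)))) ^ 2 :=
    ((isBddMeas_QHat σ hκ heven N).sub ((IsBddMeas.const _).add ((IsBddMeas.sum _ fun n _ =>
      hg.comp (measurable_pi_apply n)).const_mul _))).pow 2
  have hmono := integral_mono (b0.integrable (Measure.pi fun _ : Fin N => μ))
    ((((b1.const_mul 3).add (b2.const_mul 3)).add (b3.const_mul 12)).integrable _) fun y => by
      simp only [QHat, V1_eq_vStat, V2_eq_vStat, V3_eq_vStat σ heven, Finset.sum_add_distrib,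
        Finset.sum_sub_distrib, mul_add, mul_sub, ← Finset.mul_sum]
      set v1 := vStat (ker1 κ σ) y
      set v2 := vStat (ker2 κ σ) y
      set v3 := vStat (ker3 κ σ) y
      set s1 := 1 / (N : ℝ) * (2 * ∑ n, piJoint κ σ μ (y n))
      set s2 := 1 / (N : ℝ) * (2 * ∑ n, linPart2 κ σ μ (y n))
      set s3 := ∑ n, linPart3 κ σ μ (y n)
      -- Cauchy–Schwarz for three summands a, b, -2c, which explains the weights 3, 3, 12.
      have key : ∀ a b c : ℝ, (a + b - 2 * c) ^ 2 ≤ 3 * a ^ 2 + 3 * b ^ 2 + 12 * c ^ 2 :=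
        fun a b c => by
          nlinarith [sq_nonneg (a - b), sq_nonneg (a + 2 * c), sq_nonneg (b + 2 * c)]
      refine le_trans (le_of_eq ?_) (key (v1 - (c1 + s1)) (v2 - (c2 + s2))
        (v3 - (c3 + 1 / (N : ℝ) * s3)))
      ring
  refine hmono.trans ?_
  rw [integral_add (((b1.const_mul 3).add (b2.const_mul 3)).integrable _)
      ((b3.const_mul 12).integrable _),
    integral_add ((b1.const_mul 3).integrable _) ((b2.const_mul 3).integrable _),
    integral_const_mul, integral_const_mul, integral_const_mul]
  have := h1 N hN
  have := h2 N hN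
  have := h3 N hN
  have e : (3 * C1 + 3 * C2 + 12 * C3) / (N : ℝ) ^ 2 =
      3 * (C1 / (N : ℝ) ^ 2) + 3 * (C2 / (N : ℝ) ^ 2) + 12 * (C3 / (N : ℝ) ^ 2) := by ring
  rw [e]
  gcongr

lemma integral_sum_mul {α X : Type*} [MeasurableSpace X] (ν : Measure X) [IsProbabilityMeasure ν]
    (s : Finset α) {f : α → X → ℝ} {g : X → ℝ} (hf : ∀ a, IsBddMeas (f a)) (hg : IsBddMeas g) :
    ∫ x, (∑ a ∈ s, f a x) * g x ∂ν = ∑ a ∈ s, ∫ x, f a x * g x ∂ν := by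
  simp only [Finset.sum_mul]
  exact integral_finsetSum _ fun a _ => ((hf a).mul hg).integrable ν

lemma integral_linPart2 (hκ : IsBddMeas κ) :
    ∫ y, linPart2 κ σ μ y ∂μ = K * theta2 κ σ μ := by
  simp only [linPart2]
  rw [integral_finsetSum _ fun l _ => ((isBddMeas_piMarg_coord σ μ hκ l).const_mul _).integrable μ]
  have h : ∀ l, ∫ y, prodMeanExcept κ σ μ l * piMarg κ σ μ l (y l) ∂μ = theta2 κ σ μ := fun l => by
    rw [integral_const_mul, prodMeanExcept, theta2, Finset.prod_erase_mul _ _ (Finset.mem_univ l)]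
  simp [h]

/-- By Fubini, averaging over the free argument supplies the missing factor π_l. -/
lemma integral_piTilde (hκ : IsBddMeas κ) (l : Fin K) :
    ∫ y, piTilde κ σ μ l (y l) ∂μ = theta3 κ σ μ := by
  have hF : IsBddMeas fun p : (Fin K → ℝ) × (Fin K → ℝ) =>
      (∏ k ∈ Finset.univ.erase l, piMarg κ σ μ k (p.2 k)) * κ ((p.2 l - p.1 l) / σ l) :=
    ((IsBddMeas.prod _ fun k _ => isBddMeas_piMarg_coord σ μ hκ k).comp measurable_snd).mul
      (isBddMeas_pair_kernel σ hκ l measurable_snd measurable_fst)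
  simp only [piTilde, theta3]
  rw [integral_integral_swap (f := fun (y x : Fin K → ℝ) =>
    (∏ k ∈ Finset.univ.erase l, piMarg κ σ μ k (x k)) * κ ((x l - y l) / σ l)) (hF.integrable _)]
  refine integral_congr_ae (ae_of_all _ fun x => ?_)
  simp only
  rw [integral_const_mul, ← Finset.prod_erase_mul Finset.univ _ (Finset.mem_univ l)]
  rfl

lemma integral_linPart3 (hκ : IsBddMeas κ) :
    ∫ y, linPart3 κ σ μ y ∂μ = (K + 1) * theta3 κ σ μ := by
  simp only [linPart3]
  rw [integral_add ((isBddMeas_prod_piMarg σ μ hκ).integrable μ)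
      ((isBddMeas_sum_piTilde σ μ hκ).integrable μ),
    integral_finsetSum _ fun l _ => (isBddMeas_piTilde_coord σ μ hκ l).integrable μ]
  simp only [integral_piTilde σ μ hκ, Finset.sum_const, Finset.card_univ, Fintype.card_fin,
    nsmul_eq_mul]
  rw [theta3]
  ring

lemma integral_linPart2_mul (hκ : IsBddMeas κ) {g : (Fin K → ℝ) → ℝ} (hg : IsBddMeas g) :
    ∫ y, linPart2 κ σ μ y * g y ∂μ =
      ∑ l, prodMeanExcept κ σ μ l * ∫ y, piMarg κ σ μ l (y l) * g y ∂μ := by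
  simp only [linPart2]
  rw [integral_sum_mul μ _ (fun l => (isBddMeas_piMarg_coord σ μ hκ l).const_mul _) hg]
  simp only [mul_assoc, integral_const_mul]

lemma integral_mul_linPart3 (hκ : IsBddMeas κ) {g : (Fin K → ℝ) → ℝ} (hg : IsBddMeas g) :
    ∫ y, g y * linPart3 κ σ μ y ∂μ =
      ∫ y, g y * ∏ k, piMarg κ σ μ k (y k) ∂μ + ∑ l, ∫ y, g y * piTilde κ σ μ l (y l) ∂μ := by
  simp only [linPart3, mul_add]
  rw [integral_add ((hg.mul (isBddMeas_prod_piMarg σ μ hκ)).integrable μ)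
    ((hg.mul (isBddMeas_sum_piTilde σ μ hκ)).integrable μ)]
  congr 1
  simp only [Finset.mul_sum]
  exact integral_finsetSum _ fun l _ => (hg.mul (isBddMeas_piTilde_coord σ μ hκ l)).integrable μ

/-- The right side is the variance of `linPart2`, whose mean is K θ₂. The next four lemmas likewise
clear the normalizing factors from the other Σ's. -/
lemma sq_mul_Sigma22 (hK : 1 ≤ K) (hκ : IsBddMeas κ) :
    (K : ℝ) ^ 2 * Sigma22 κ σ μ =
      ∫ y, linPart2 κ σ μ y * linPart2 κ σ μ y ∂μ - (K * theta2 κ σ μ) ^ 2 := by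
  have hK0 : (K : ℝ) ≠ 0 := by exact_mod_cast (Nat.one_le_iff_ne_zero.1 hK)
  have h : ∀ l, ∫ y, piMarg κ σ μ l (y l) * linPart2 κ σ μ y ∂μ =
      ∑ m, prodMeanExcept κ σ μ m * ∫ y, piMarg κ σ μ l (y l) * piMarg κ σ μ m (y m) ∂μ := by
    intro l
    simp only [mul_comm (piMarg κ σ μ l _)]
    exact integral_linPart2_mul σ μ hκ (isBddMeas_piMarg_coord σ μ hκ l)
  rw [integral_linPart2_mul σ μ hκ (isBddMeas_linPart2 σ μ hκ), Sigma22]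
  simp only [h, Finset.mul_sum, mul_assoc]
  simp only [← Finset.mul_sum]
  field_simp

lemma sq_mul_Sigma33 (hκ : IsBddMeas κ) :
    ((K : ℝ) + 1) ^ 2 * Sigma33 κ σ μ =
      ∫ y, linPart3 κ σ μ y * linPart3 κ σ μ y ∂μ - ((K + 1) * theta3 κ σ μ) ^ 2 := by
  have hK0 : (K : ℝ) + 1 ≠ 0 := by positivity
  have hP := isBddMeas_prod_piMarg σ μ hκ
  have hT := isBddMeas_piTilde_coord σ μ hκ
  have h1 : ∫ y, linPart3 κ σ μ y * ∏ k, piMarg κ σ μ k (y k) ∂μ =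
      ∫ y, ∏ k, piMarg κ σ μ k (y k) ^ 2 ∂μ +
        ∑ l, ∫ y, (∏ k, piMarg κ σ μ k (y k)) * piTilde κ σ μ l (y l) ∂μ := by
    simp only [mul_comm (linPart3 κ σ μ _), pow_two, Finset.prod_mul_distrib]
    exact integral_mul_linPart3 σ μ hκ hP
  have h2 : ∀ l, ∫ y, linPart3 κ σ μ y * piTilde κ σ μ l (y l) ∂μ =
      ∫ y, (∏ k, piMarg κ σ μ k (y k)) * piTilde κ σ μ l (y l) ∂μ +
        ∑ m, ∫ y, piTilde κ σ μ l (y l) * piTilde κ σ μ m (y m) ∂μ := by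
    intro l
    have := integral_mul_linPart3 σ μ hκ (hT l)
    simp only [mul_comm (linPart3 κ σ μ _), mul_comm (∏ k, piMarg κ σ μ k _)]
    exact this
  rw [integral_mul_linPart3 σ μ hκ (isBddMeas_linPart3 σ μ hκ), h1]
  simp only [h2, Finset.sum_add_distrib]
  rw [Sigma33]
  field_simp
  ring

lemma mul_Sigma12 (hK : 1 ≤ K) (hκ : IsBddMeas κ) :
    (K : ℝ) * Sigma12 κ σ μ =
      ∫ y, linPart2 κ σ μ y * piJoint κ σ μ y ∂μ - theta1 κ σ μ * (K * theta2 κ σ μ) := by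
  have hK0 : (K : ℝ) ≠ 0 := by exact_mod_cast (Nat.one_le_iff_ne_zero.1 hK)
  rw [integral_linPart2_mul σ μ hκ (isBddMeas_piJoint σ μ hκ), Sigma12]
  field_simp

lemma mul_Sigma13 (hκ : IsBddMeas κ) :
    ((K : ℝ) + 1) * Sigma13 κ σ μ =
      ∫ y, piJoint κ σ μ y * linPart3 κ σ μ y ∂μ - theta1 κ σ μ * ((K + 1) * theta3 κ σ μ) := by
  have hK0 : (K : ℝ) + 1 ≠ 0 := by positivity
  rw [integral_mul_linPart3 σ μ hκ (isBddMeas_piJoint σ μ hκ), Sigma13]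
  field_simp

lemma mul_Sigma23 (hK : 1 ≤ K) (hκ : IsBddMeas κ) :
    (K : ℝ) * ((K : ℝ) + 1) * Sigma23 κ σ μ =
      ∫ y, linPart2 κ σ μ y * linPart3 κ σ μ y ∂μ
        - K * theta2 κ σ μ * ((K + 1) * theta3 κ σ μ) := by
  have hK0 : (K : ℝ) ≠ 0 := by exact_mod_cast (Nat.one_le_iff_ne_zero.1 hK)
  have hK1 : (K : ℝ) + 1 ≠ 0 := by positivity
  rw [integral_linPart2_mul σ μ hκ (isBddMeas_linPart3 σ μ hκ), Sigma23]
  simp only [integral_mul_linPart3 σ μ hκ (isBddMeas_piMarg_coord σ μ hκ _), mul_add,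
    Finset.sum_add_distrib, Finset.mul_sum]
  simp only [← Finset.mul_sum]
  field_simp

/-- The variance of the linear part of `QHat`. -/
lemma variance_linPart (hK : 1 ≤ K) (hκ : IsBddMeas κ) :
    variance (fun y => 2 * piJoint κ σ μ y + 2 * linPart2 κ σ μ y - 2 * linPart3 κ σ μ y) μ =
      4 * Sigma11 κ σ μ + 4 * ((K : ℝ) ^ 2 * Sigma22 κ σ μ)
        + 4 * (((K : ℝ) + 1) ^ 2 * Sigma33 κ σ μ)
        - 8 * (((K : ℝ) + 1) * Sigma13 κ σ μ)
        - 8 * ((K : ℝ) * ((K : ℝ) + 1) * Sigma23 κ σ μ)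
        + 8 * ((K : ℝ) * Sigma12 κ σ μ) := by
  have hJ := isBddMeas_piJoint σ μ hκ
  have hL2 := isBddMeas_linPart2 σ μ hκ
  have hL3 := isBddMeas_linPart3 σ μ hκ
  have cov_eq : ∀ {f g : (Fin K → ℝ) → ℝ}, IsBddMeas f → IsBddMeas g →
      covariance f g μ = ∫ y, f y * g y ∂μ - (∫ y, f y ∂μ) * ∫ y, g y ∂μ := fun hf hg =>
    covariance_eq_sub (hf.memLp μ 2) (hg.memLp μ 2)
  have var_eq : ∀ {f : (Fin K → ℝ) → ℝ}, IsBddMeas f →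
      variance f μ = ∫ y, f y * f y ∂μ - (∫ y, f y ∂μ) * ∫ y, f y ∂μ := fun hf => by
    rw [← covariance_self hf.measurable.aemeasurable, cov_eq hf hf]
  have hadd : covariance (fun y => 2 * piJoint κ σ μ y + 2 * linPart2 κ σ μ y)
      (fun y => 2 * linPart3 κ σ μ y) μ =
      covariance (fun y => 2 * piJoint κ σ μ y) (fun y => 2 * linPart3 κ σ μ y) μ +
        covariance (fun y => 2 * linPart2 κ σ μ y) (fun y => 2 * linPart3 κ σ μ y) μ :=
    covariance_add_left ((hJ.const_mul 2).memLp μ 2) ((hL2.const_mul 2).memLp μ 2)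
      ((hL3.const_mul 2).memLp μ 2)
  rw [variance_fun_sub (((hJ.const_mul 2).add (hL2.const_mul 2)).memLp μ 2)
      ((hL3.const_mul 2).memLp μ 2),
    variance_fun_add ((hJ.const_mul 2).memLp μ 2) ((hL2.const_mul 2).memLp μ 2),
    hadd]
  simp only [variance_const_mul, covariance_const_mul_left, covariance_const_mul_right]
  rw [sq_mul_Sigma22 σ μ hK hκ, sq_mul_Sigma33 σ μ hκ, mul_Sigma13 σ μ hκ, mul_Sigma23 σ μ hK hκ,
    mul_Sigma12 σ μ hK hκ, Sigma11, var_eq hJ, var_eq hL2, var_eq hL3, cov_eq hJ hL2,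
    cov_eq hJ hL3, cov_eq hL2 hL3, integral_linPart2 σ μ hκ, integral_linPart3 σ μ hκ]
  simp only [theta1, pow_two, mul_comm (piJoint κ σ μ _) (linPart2 κ σ μ _)]
  ring

end Variance

end QuadDep

end

/-! ### Transfer to the random sample -/

theorem mainTheorem6 {K : ℕ} (hK : 1 ≤ K)
    -- a square integrable kernel, a bandwidth, and the kernel `κ = 𝒦_{2,h}`
    (𝒦 : ℝ → ℝ) (h𝒦 : MemLp 𝒦 2 volume) (h : ℝ) (hh : 0 < h)
    (κ : ℝ → ℝ) (hκ : κ = QuadDep.rescale (QuadDep.mirrorConv 𝒦) h)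
    -- known scale factors
    (σ : Fin K → ℝ) (hσ : ∀ k, 0 < σ k)
    -- independent observations `Y 0, Y 1, …` with common law `μ` on `ℝ^K`
    {Ω : Type*} [MeasurableSpace Ω] (P : Measure Ω) [IsProbabilityMeasure P]
    (μ : Measure (Fin K → ℝ)) (Y : ℕ → Ω → Fin K → ℝ)
    (hlaw : ∀ n, HasLaw (Y n) μ P) (hindep : iIndepFun Y P)
    -- the sample of the first `N` observations
    (S : (N : ℕ) → Ω → Fin N → Fin K → ℝ) (hS : ∀ N ω n, S N ω n = Y n ω) :
    -- decomposition into U-statistics and remainders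
    (∀ N : ℕ, 1 ≤ N → ∀ ω,
      QuadDep.V1 κ σ (S N ω) =
          ((N : ℝ) - 1) / N * QuadDep.U1 κ σ (S N ω) + QuadDep.b1 K N κ / √(N : ℝ) ∧
      QuadDep.V2 κ σ (S N ω) =
          (N.choose (2 * K) * (2 * K).factorial : ℝ) / (N : ℝ) ^ (2 * K)
            * QuadDep.U2 κ σ (S N ω) + QuadDep.b2 κ σ (S N ω) / √(N : ℝ) ∧
      QuadDep.V3 κ σ (S N ω) =
          (N.choose (K + 1) * (K + 1).factorial : ℝ) / (N : ℝ) ^ (K + 1)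
            * QuadDep.U3 κ σ (S N ω) + QuadDep.b3 κ σ (S N ω) / √(N : ℝ)) ∧
    -- the remainders are `O(1/N)`, uniformly in the sample
    (∃ C : ℝ, ∀ N : ℕ, 1 ≤ N → ∀ ω,
      |QuadDep.b1 K N κ / √(N : ℝ)| ≤ C / N ∧
      |QuadDep.b2 κ σ (S N ω) / √(N : ℝ)| ≤ C / N ∧
      |QuadDep.b3 κ σ (S N ω) / √(N : ℝ)| ≤ C / N) ∧
    Tendsto (fun N : ℕ => QuadDep.b1 K N κ ^ 2) atTop (𝓝 0) ∧
    (∀ N, MemLp (fun ω => QuadDep.b2 κ σ (S N ω)) 2 P) ∧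
    Tendsto (fun N : ℕ => ∫ ω, QuadDep.b2 κ σ (S N ω) ^ 2 ∂P) atTop (𝓝 0) ∧
    (∀ N, MemLp (fun ω => QuadDep.b3 κ σ (S N ω)) 2 P) ∧
    Tendsto (fun N : ℕ => ∫ ω, QuadDep.b3 κ σ (S N ω) ^ 2 ∂P) atTop (𝓝 0) ∧
    -- the expansion of the variance
    (∀ N, MemLp (fun ω => QuadDep.QHat κ σ (S N ω)) 2 P) ∧
    (fun N : ℕ => variance (fun ω => QuadDep.QHat κ σ (S N ω)) P -
        (4 / (N : ℝ) * QuadDep.Sigma11 κ σ μ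
          + 4 * (K : ℝ) ^ 2 / N * QuadDep.Sigma22 κ σ μ
          + 4 * (((K : ℝ) + 1) ^ 2 / N) * QuadDep.Sigma33 κ σ μ
          - 8 * (((K : ℝ) + 1) / N) * QuadDep.Sigma13 κ σ μ
          - 8 * ((K : ℝ) * ((K : ℝ) + 1) / N) * QuadDep.Sigma23 κ σ μ
          + 8 * (K : ℝ) / N * QuadDep.Sigma12 κ σ μ))
      =o[atTop] (fun N : ℕ => 1 / (N : ℝ)) ∧
    Tendsto (fun N : ℕ => variance (fun ω => QuadDep.QHat κ σ (S N ω)) P) atTop (𝓝 0) := by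
  have hμ : IsProbabilityMeasure μ := (hlaw 0).isProbabilityMeasure_iff.1 inferInstance
  have hbdd : QuadDep.IsBddMeas κ := hκ ▸ QuadDep.isBddMeas_rescale_mirrorConv h𝒦 h
  have heven : ∀ x, κ (-x) = κ x := fun x => by
    rw [hκ]
    exact QuadDep.rescale_mirrorConv_neg h x
  have hS' : ∀ N, S N = fun ω (n : Fin N) => Y n ω := fun N => by
    funext ω n
    exact hS N ω n
  -- The first N observations have the product law, so variances over Ω may be computed under
  -- `Measure.pi`.
  have hsample : ∀ N, HasLaw (S N) (Measure.pi fun _ : Fin N => μ) P := fun N => by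
    rw [hS' N]
    exact (hindep.precomp Fin.val_injective).hasLaw_pi fun n : Fin N => hlaw n
  have hmem : ∀ N {f : (Fin N → Fin K → ℝ) → ℝ}, QuadDep.IsBddMeas f →
      MemLp (fun ω => f (S N ω)) 2 P := fun N f hf => by
    obtain ⟨C, hC⟩ := hf.bounded
    exact MemLp.of_bound (hf.measurable.comp_aemeasurable
      (hsample N).aemeasurable).aestronglyMeasurable C (ae_of_all _ fun ω => hC _)
  have hvar : ∀ N, variance (fun ω => QuadDep.QHat κ σ (S N ω)) P =
      variance (fun y => QuadDep.QHat κ σ y) (Measure.pi fun _ : Fin N => μ) := fun N => by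
    rw [← (hsample N).map_eq, variance_map
      (QuadDep.isBddMeas_QHat σ hbdd heven N).measurable.aemeasurable (hsample N).aemeasurable]
    rfl
  obtain ⟨C2, hC2⟩ := QuadDep.exists_abs_b2_div_sqrt_le σ hbdd
  obtain ⟨C3, hC3⟩ := QuadDep.exists_abs_b3_div_sqrt_le σ hbdd
  have hb2 := fun N => hmem N (QuadDep.isBddMeas_b2 σ hbdd N)
  have hb3 := fun N => hmem N (QuadDep.isBddMeas_b3 σ hbdd N)
  obtain ⟨c, C, hC⟩ := QuadDep.QHat_linearization σ μ hK hbdd heven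
  have hg := (((QuadDep.isBddMeas_piJoint σ μ hbdd).const_mul 2).add
    ((QuadDep.isBddMeas_linPart2 σ μ hbdd).const_mul 2)).sub
    ((QuadDep.isBddMeas_linPart3 σ μ hbdd).const_mul 2)
  have hexp := QuadDep.variance_sub_isLittleO μ (QuadDep.isBddMeas_QHat σ hbdd heven) hg hC
  refine ⟨fun N hN ω => ⟨QuadDep.V1_decomposition σ heven hN _,
      QuadDep.V2_decomposition σ hN _, QuadDep.V3_decomposition σ heven hN _⟩,
    ⟨max |κ 0 ^ K| (max C2 C3), fun N hN ω => ⟨?_, ?_, ?_⟩⟩, ?_, hb2, ?_, hb3, ?_,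
    fun N => hmem N (QuadDep.isBddMeas_QHat σ hbdd heven N), ?_, ?_⟩
  · refine (QuadDep.abs_b1_div_sqrt_le N).trans ?_
    gcongr
    exact le_max_left _ _
  · refine (hC2 N hN _).trans ?_
    gcongr
    exact (le_max_left _ _).trans (le_max_right _ _)
  · refine (hC3 N hN _).trans ?_
    gcongr
    exact (le_max_right _ _).trans (le_max_right _ _)
  · simpa using QuadDep.tendsto_integral_sq_zero (P := P) (b := fun N _ => QuadDep.b1 K N κ)
      (fun N => memLp_const _) fun N _ _ => QuadDep.abs_b1_div_sqrt_le N
  · exact QuadDep.tendsto_integral_sq_zero hb2 fun N hN ω => hC2 N hN _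
  · exact QuadDep.tendsto_integral_sq_zero hb3 fun N hN ω => hC3 N hN _
  · refine hexp.congr_left fun N => ?_
    rw [hvar, QuadDep.variance_linPart σ μ hK hbdd]
    ring
  -- The variance is the o(1/N) error plus var(g)/N, and both tend to zero.
  · have h0 := (hexp.trans_tendsto tendsto_one_div_atTop_nhds_zero_nat).add
      (tendsto_const_div_atTop_nhds_zero_nat (variance (fun y => 2 * QuadDep.piJoint κ σ μ y +
        2 * QuadDep.linPart2 κ σ μ y - 2 * QuadDep.linPart3 κ σ μ y) μ))
    simpa [hvar] using h0
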